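/- **Proposition 4.1.** Let $p,q\in\mathbb C[x]$, and let $s:[0,1]\to\mathbb C$ be a (continuous) path from $a$ to $b$ with $q(b)\neq 0$. For $y_a\in\mathbb C$ let $y(y_a,x)$ be the solution of the Abel equation $y'=p(x)y^2+q(x)y^3$, holomorphic near $x=a$, with $y(y_a,a)=y_a$. Let $y_a^0\in\mathbb C$ be such that $y(y_a^0,x)$ can be analytically continued along $s$ over the parameters $t\in[0,1)$, but not over the whole of $[0,1]$; that is, its continuation along $s$ has a singularity at the endpoint $b$, and only there. Then there is a germ of a real curve $\gamma\subset\mathbb C$ at $y_a^0$ such that, for all $y_a\notin\gamma$ in some neighbourhood of $y_a^0$, the solution $y(y_a,x)$ can be analytically continued along the whole path $s$, and so is regular at each point of $s$ including the endpoint $b$. Here "germ of a real curve" means a curve of the same nature as $s$: for some $t_0<1$, $\gamma$ is represented by the arc $\gamma(t)=\psi(s(t))$, $t\in[t_0,1]$, with $\gamma(1)=y_a^0$, where $\psi$ is an injective holomorphic map defined on an open neighbourhood of $b$ that contains $s([t_0,1])$, and $\psi(b)=y_a^0$. (So $\gamma$ is, for example, $C^k$, piecewise smooth, real analytic or a simple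 arc if $s$ is so near $b$.) -/

import Mathlib

open Filter Topology Polynomial

/-- The function `g` is, near `a`, a solution of the polynomial Abel equation
`y' = p(x) y ^ 2 + q(x) y ^ 3` (complex derivative) with initial value `g a = w`. -/
def IsAbelSolutionGerm (p q : ℂ[X]) (a w : ℂ) (g : ℂ → ℂ) : Prop :=
  g a = w ∧
    ∀ᶠ x in 𝓝 a, HasDerivAt g (p.eval x * g x ^ 2 + q.eval x * g x ^ 3) x

/-- Analytic continuation along the part of the path `s` with parameters in `J`: a family `f t` of
function elements, `f t` being analytic at the point `s t`, such that for `t'` in `J` close to `t`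
the germ of `f t'` at `s t'` is the one given by `f t`. Only the germ of `f t` at `s t` matters.
The family is indexed by the parameter, so different passages of `s` through the same point
may carry different branches. -/
structure IsContinuationAlong {a b : ℂ} (s : Path a b) (J : Set unitInterval)
    (f : unitInterval → ℂ → ℂ) : Prop where
  analyticAt : ∀ t ∈ J, AnalyticAt ℂ (f t) (s t)
  compatible : ∀ t ∈ J, ∀ᶠ t' in 𝓝[J] t, f t' =ᶠ[𝓝 (s t')] f t

/-- The solution of the Abel equation with value `w` at the starting point `a` of `s` can be
analytically continued along `s` over the parameters in `J` (a set containing `0`), so that the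
continued solution is regular at all the corresponding points of `s`. -/
def AbelRegularAlong (p q : ℂ[X]) {a b : ℂ} (s : Path a b) (J : Set unitInterval) (w : ℂ) : Prop :=
  ∃ f : unitInterval → ℂ → ℂ, IsAbelSolutionGerm p q a w (f 0) ∧ IsContinuationAlong s J f

/-- The arc `γ` (with parameters in `[t₀, 1]`) represents a germ at `w` of a real curve of the same
nature as the path `s` near its endpoint `b`: it is a continuous arc that ends at `w`, and it is the
image of the final arc `s ([t₀, 1])` under a biholomorphic map `ψ` from a neighbourhood `V` of `b`
onto its image, with `ψ b = w`. In particular `γ` is of class `C ^ k`, piecewise regular,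
real analytic, a simple arc, ... near `w` whenever `s` is so near `b`. -/
def IsRealCurveGermLike {a b : ℂ} (s : Path a b) (w : ℂ) (t₀ : unitInterval)
    (γ : unitInterval → ℂ) : Prop :=
  ContinuousOn γ (Set.Icc t₀ 1) ∧ γ 1 = w ∧
    ∃ (V : Set ℂ) (ψ : ℂ → ℂ), IsOpen V ∧ b ∈ V ∧ DifferentiableOn ℂ ψ V ∧ Set.InjOn ψ V ∧
      Set.MapsTo s (Set.Icc t₀ 1) V ∧ ∀ t ∈ Set.Icc t₀ 1, γ t = ψ (s t)

/-! In the coordinate `u = 1 / y` the Abel equation describes the integral curves of the field `(-u,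
p u + q)`. Since `q b ≠ 0`, this field is regular at `(b, 0)` and transverse there to the line `u =
0`. Straightening it gives a holomorphic first integral `C` with `C (x, 0) = x`
(`exists_firstIntegral`), so a solution near infinity on the level `c` can blow up only at `x = c`.

The given solution must tend to infinity at the end of `s`: a finite cluster value would allow
continuation by local solvability (`tendsto_cocompact_of_not_regular`). Hence near the end it lies
on the level `b` (`AbelFirstIntegral.level_eq_endpoint`). Fix `t₁ < 1` near the end. Nearby initial
values `w` are transported to `s t₁` with nonzero derivative (`exists_abel_transport`), so the level
`c w` of the transported solution is a local biholomorphism with `c ya0 = b`. If `c w` is not on the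
remaining part of `s`, compactness of the level set over that part keeps the solution away from
infinity, and it reaches the endpoint (`AbelFirstIntegral.regular_of_level`). The exceptional values
are therefore the preimage of `s` under `c`, and `ψ` is the local inverse of `c`. -/

/-! ### Holomorphic flows by the implicit function theorem on spaces of curves -/

section Flow

open unitInterval

variable {E : Type*} [NormedAddCommGroup E]

/-- The extension of a curve on `[0, 1]` to `ℝ`, constant outside `[0, 1]`. -/
noncomputable def extendCurve (z : C(I, E)) (τ : ℝ) : E := z (Set.projIcc 0 1 zero_le_one τ)

theorem continuous_extendCurve (z : C(I, E)) : Continuous (extendCurve z) :=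
  z.continuous.comp continuous_projIcc

theorem extendCurve_coe (z : C(I, E)) (θ : I) : extendCurve z θ = z θ := by
  simp [extendCurve]

theorem extendCurve_of_mem (z : C(I, E)) {τ : ℝ} (h : τ ∈ Set.Icc (0 : ℝ) 1) :
    extendCurve z τ = z ⟨τ, h⟩ := by
  simp [extendCurve, Set.projIcc_of_mem _ h]

theorem norm_extendCurve_le (z : C(I, E)) (τ : ℝ) : ‖extendCurve z τ‖ ≤ ‖z‖ :=
  z.norm_coe_le_norm _

/-- The curve `z` run up to parameter `θ` only, rescaled to `[0, 1]`. -/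
noncomputable def rescaleCurve (θ : I) (z : C(I, E)) : C(I, E) :=
  ⟨fun τ => z (θ * τ), by fun_prop⟩

theorem rescaleCurve_apply (θ τ : I) (z : C(I, E)) : rescaleCurve θ z τ = z (θ * τ) := rfl

theorem norm_rescaleCurve_sub_const_le (θ : I) (z : C(I, E)) (w : E) :
    ‖rescaleCurve θ z - ContinuousMap.const I w‖ ≤ ‖z - ContinuousMap.const I w‖ := by
  rw [ContinuousMap.norm_le _ (norm_nonneg _)]
  intro τ
  exact (z - ContinuousMap.const I w).norm_coe_le_norm (θ * τ)

variable [NormedSpace ℂ E] [CompleteSpace E]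

/-- The primitive `θ ↦ ∫₀^θ z` as a continuous linear operator on curves. -/
noncomputable def curvePrimitive (E : Type*) [NormedAddCommGroup E] [NormedSpace ℂ E]
    [CompleteSpace E] : C(I, E) →L[ℂ] C(I, E) :=
  LinearMap.mkContinuous
    { toFun := fun z =>
        ⟨fun θ => ∫ τ in (0 : ℝ)..θ, extendCurve z τ,
          (intervalIntegral.continuous_primitive
            (fun _ _ => (continuous_extendCurve z).intervalIntegrable _ _) 0).comp
            continuous_subtype_val⟩
      map_add' := fun z w => by
        ext θ
        exact intervalIntegral.integral_add
          ((continuous_extendCurve z).intervalIntegrable _ _)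
          ((continuous_extendCurve w).intervalIntegrable _ _)
      map_smul' := fun c z => by
        ext θ
        exact intervalIntegral.integral_smul c _ }
    1 (fun z => by
      rw [one_mul, ContinuousMap.norm_le _ (norm_nonneg _)]
      intro θ
      have h := intervalIntegral.norm_integral_le_of_norm_le_const (a := (0 : ℝ)) (b := θ)
        (f := extendCurve z) (C := ‖z‖) (fun τ _ => norm_extendCurve_le z τ)
      refine h.trans ?_
      have h0 : |(θ : ℝ) - 0| ≤ 1 := by
        rw [sub_zero, abs_of_nonneg θ.2.1]; exact θ.2.2
      exact mul_le_of_le_one_right (norm_nonneg _) h0)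

theorem curvePrimitive_apply (z : C(I, E)) (θ : I) :
    curvePrimitive E z θ = ∫ τ in (0 : ℝ)..θ, extendCurve z τ := rfl

/-- A linear substitution in the integral. It turns the integral equation for time `ζ` into the one
for time `θ ζ`. -/
theorem curvePrimitive_rescaleCurve (θ τ : I) (z : C(I, E)) :
    (θ : ℝ) • curvePrimitive E (rescaleCurve θ z) τ = curvePrimitive E z (θ * τ) := by
  rw [curvePrimitive_apply, curvePrimitive_apply]
  have h : ∀ ρ ∈ Set.uIcc (0 : ℝ) τ, extendCurve (rescaleCurve θ z) ρ =
      extendCurve z (θ * ρ) := by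
    intro ρ hρ
    rw [Set.uIcc_of_le τ.2.1] at hρ
    have h1 : ρ ∈ Set.Icc (0 : ℝ) 1 := ⟨hρ.1, hρ.2.trans τ.2.2⟩
    rw [extendCurve_of_mem _ h1, rescaleCurve_apply, ← extendCurve_coe]
    rfl
  rw [intervalIntegral.integral_congr h, intervalIntegral.smul_integral_comp_mul_left]
  simp

/-- **Holomorphic flow.** A vector field `V` whose superposition operator `N` on curves is
continuously differentiable has a local flow `Φ (ζ, w)`, continuously differentiable in the complex
time `ζ` and the initial value `w`. -/
theorem exists_holomorphic_flow {V : E → E} {N : C(I, E) → C(I, E)}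
    (hN : ContDiff ℂ 1 N) (hNV : ∀ z θ, N z θ = V (z θ)) (w₀ : E) :
    ∃ Φ : ℂ × E → E, ContDiffAt ℂ 1 Φ (0, w₀) ∧
      (∀ᶠ l in 𝓝 ((0 : ℂ), w₀), HasDerivAt (fun ζ => Φ (ζ, l.2)) (V (Φ l)) l.1) ∧
      ∀ᶠ w in 𝓝 w₀, Φ (0, w) = w := by
  let K : E →L[ℂ] C(I, E) := LinearMap.mkContinuous
    { toFun := fun w => ContinuousMap.const I w
      map_add' := fun _ _ => rfl
      map_smul' := fun _ _ => rfl } 1 (fun w => by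
        rw [one_mul, ContinuousMap.norm_le _ (norm_nonneg _)]
        intro θ; exact le_rfl)
  have hK : ∀ w θ, K w θ = w := fun _ _ => rfl
  -- Zeros of `H` solve the integral equation of the flow with the complex time `ζ` moved into the
  -- coefficient, so that every curve lives on `[0, 1]`.
  let H : (ℂ × E) × C(I, E) → C(I, E) := fun v =>
    v.2 - K v.1.2 - v.1.1 • curvePrimitive E (N v.2)
  let u : (ℂ × E) × C(I, E) := ((0, w₀), K w₀)
  have hHc : ContDiff ℂ 1 H := by
    have h1 : ContDiff ℂ 1 fun v : (ℂ × E) × C(I, E) => N v.2 := hN.comp contDiff_snd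
    fun_prop
  have hH : ContDiffAt ℂ 1 H u := hHc.contDiffAt
  -- At `ζ = 0` the integral term vanishes, so the partial derivative in the curve is the identity.
  have hinv : (fderiv ℂ H u ∘L .inr ℂ (ℂ × E) C(I, E)).IsInvertible := by
    have h1 : HasFDerivAt (fun z => H (u.1, z))
        (fderiv ℂ H u ∘L .inr ℂ (ℂ × E) C(I, E)) u.2 :=
      (hHc.differentiable one_ne_zero u).hasFDerivAt.comp u.2
        (hasFDerivAt_prodMk_right u.1 u.2)
    have h2 : HasFDerivAt (fun z => H (u.1, z)) (.id ℂ C(I, E)) u.2 := by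
      have : (fun z => H (u.1, z)) = fun z => z - K w₀ := by
        funext z; simp [H, u]
      rw [this]
      exact (hasFDerivAt_id _).sub_const _
    rw [h1.unique h2]
    exact ⟨ContinuousLinearEquiv.refl ℂ _, rfl⟩
  have hHu : H u = 0 := by simp [H, u]
  let S := hH.implicitFunction one_ne_zero hinv
  have hSu : S (0, w₀) = K w₀ := hH.implicitFunction_apply_self one_ne_zero hinv
  have hSc : ContDiffAt ℂ 1 S (0, w₀) := hH.contDiffAt_implicitFunction one_ne_zero hinv
  have hSeq : ∀ᶠ l in 𝓝 ((0 : ℂ), w₀), H (l, S l) = 0 := by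
    have := hH.eventually_apply_implicitFunction one_ne_zero hinv
    rwa [hHu] at this
  have hSiff : ∀ᶠ v in 𝓝 u, H v = 0 ↔ S v.1 = v.2 := by
    have := hH.eventually_apply_eq_iff_implicitFunction one_ne_zero hinv
    rwa [hHu] at this
  obtain ⟨δ, hδ, hball⟩ := Metric.eventually_nhds_iff_ball.1 hSiff
  have hnear : ∀ᶠ l in 𝓝 ((0 : ℂ), w₀), ‖S l - K w₀‖ < δ := by
    have h1 : ContinuousAt (fun l => ‖S l - K w₀‖) (0, w₀) :=
      (hSc.continuousAt.sub continuousAt_const).norm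
    have h2 : ‖S (0, w₀) - K w₀‖ < δ := by rw [hSu]; simpa using hδ
    exact h1.eventually_lt continuousAt_const h2
  have hdiff : ∀ᶠ l in 𝓝 ((0 : ℂ), w₀), DifferentiableAt ℂ S l :=
    (hSc.eventually (by simp)).mono fun l hl => hl.differentiableAt one_ne_zero
  have hbl : ∀ᶠ l in 𝓝 ((0 : ℂ), w₀), l ∈ Metric.ball ((0 : ℂ), w₀) δ :=
    Metric.ball_mem_nhds _ hδ
  have hfix : ∀ l : ℂ × E, H (l, S l) = 0 → ∀ θ, S l θ = l.2 + l.1 • curvePrimitive E (N (S l)) θ := by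
    intro l hl θ
    have := congrArg (fun z : C(I, E) => z θ) hl
    simp only [H, ContinuousMap.sub_apply, ContinuousMap.smul_apply, ContinuousMap.zero_apply,
      hK] at this
    rw [sub_sub, sub_eq_zero] at this
    exact this
  -- The rescaled curve solves the equation for time `θ ζ` and stays in the ball where the implicit
  -- function theorem gives uniqueness.
  have hscale : ∀ᶠ l in 𝓝 ((0 : ℂ), w₀), ∀ θ : I, S ((θ : ℝ) • l.1, l.2) 1 = S l θ := by
    filter_upwards [hSeq, hnear, hbl] with l h1 h2 h3 θ
    have hmem : (((θ : ℝ) • l.1, l.2), rescaleCurve θ (S l)) ∈ Metric.ball u δ := by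
      rw [Metric.mem_ball, dist_eq_norm, Prod.norm_def, Prod.norm_def] at *
      simp only [Prod.fst_sub, Prod.snd_sub, u, sub_zero, max_lt_iff] at *
      refine ⟨⟨?_, h3.2⟩, lt_of_le_of_lt (norm_rescaleCurve_sub_const_le θ _ w₀) h2⟩
      rw [norm_smul]
      refine lt_of_le_of_lt (mul_le_of_le_one_left (norm_nonneg _) ?_) h3.1
      rw [Real.norm_of_nonneg θ.2.1]; exact θ.2.2
    have hz : H (((θ : ℝ) • l.1, l.2), rescaleCurve θ (S l)) = 0 := by
      ext τ
      have hNr : N (rescaleCurve θ (S l)) = rescaleCurve θ (N (S l)) := by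
        ext ρ; rw [hNV, rescaleCurve_apply, rescaleCurve_apply, hNV]
      simp only [H, ContinuousMap.sub_apply, ContinuousMap.smul_apply, ContinuousMap.zero_apply, hK,
        hNr, rescaleCurve_apply]
      rw [hfix l h1 (θ * τ), ← curvePrimitive_rescaleCurve, smul_assoc,
        smul_comm l.1 (θ : ℝ)]
      abel
    have := (hball _ hmem).1 hz
    simp only at this
    rw [this, rescaleCurve_apply, mul_one]
  let ev : C(I, E) →L[ℂ] E := ContinuousMap.evalCLM ℂ (1 : I)
  have hev : ∀ z, ev z = z 1 := fun _ => rfl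
  refine ⟨fun l => ev (S l), ev.contDiff.contDiffAt.comp _ hSc, ?_, ?_⟩
  · filter_upwards [hscale, hSeq.eventually_nhds, hdiff] with l h1 h2 h3
    have hd : HasDerivAt (fun ζ => ev (S (ζ, l.2))) (deriv (fun ζ => ev (S (ζ, l.2))) l.1) l.1 := by
      apply DifferentiableAt.hasDerivAt
      refine ev.differentiableAt.comp l.1 ?_
      exact DifferentiableAt.comp l.1 (by exact h3)
        ((differentiableAt_id).prodMk (differentiableAt_const _))
    -- For `ζ ≠ 0` the derivative comes from differentiating `hscale` in the real variable `θ` at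
    -- `1` and cancelling the factor `ζ`. At `ζ = 0` that factor is lost, and the difference
    -- quotient is read off the integral equation.
    by_cases hl : l.1 = 0
    · have hev2 : (fun ζ => ev (S (ζ, l.2))) =ᶠ[𝓝 l.1]
          fun ζ => l.2 + ζ • ev (curvePrimitive E (N (S (ζ, l.2)))) := by
        have ht : Tendsto (fun ζ : ℂ => (ζ, l.2)) (𝓝 l.1) (𝓝 l) :=
          (continuous_id.prodMk continuous_const).tendsto l.1
        filter_upwards [ht.eventually h2] with ζ hζ
        exact hfix _ hζ 1
      refine HasDerivAt.congr_of_eventuallyEq ?_ hev2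
      refine HasDerivAt.const_add _ ?_
      have hcont : ContinuousAt (fun ζ => ev (curvePrimitive E (N (S (ζ, l.2))))) l.1 := by
        have hS : ContinuousAt (fun ζ => S (ζ, l.2)) l.1 :=
          ContinuousAt.comp (g := S) (f := fun ζ => (ζ, l.2)) h3.continuousAt
            (continuous_id.prodMk continuous_const).continuousAt
        exact ev.continuous.continuousAt.comp
          ((curvePrimitive E).continuous.continuousAt.comp (hN.continuous.continuousAt.comp hS))
      have hval : ev (curvePrimitive E (N (S l))) = V (ev (S l)) := by
        have hconst : ∀ θ, S l θ = l.2 := fun θ => by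
          rw [hfix l h2.self_of_nhds θ, hl, zero_smul, add_zero]
        rw [hev, hev, hconst, curvePrimitive_apply]
        have : ∀ τ, extendCurve (N (S l)) τ = V l.2 := fun τ => by
          rw [extendCurve, hNV, hconst]
        simp [this]
      rw [hasDerivAt_iff_tendsto_slope]
      rw [← hval]
      have := hcont.tendsto.mono_left (nhdsWithin_le_nhds (s := {l.1}ᶜ))
      refine this.congr' ?_
      filter_upwards [self_mem_nhdsWithin] with ζ hζ
      rw [slope_def_module, hl]
      have : ζ ≠ 0 := by rw [← hl]; exact hζ
      simp [smul_smul, this]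
    · have hk : HasDerivAt (fun θ : ℝ => ev (S ((θ • l.1, l.2))))
          (l.1 • deriv (fun ζ => ev (S (ζ, l.2))) l.1) 1 := by
        have hin : HasDerivAt (fun θ : ℝ => θ • l.1) l.1 1 := by
          simpa using (hasDerivAt_id (1 : ℝ)).smul_const l.1
        have h1l : (1 : ℝ) • l.1 = l.1 := one_smul _ _
        rw [← h1l] at hd
        have := HasDerivAt.scomp (1 : ℝ) hd hin
        rw [h1l] at this
        exact this
      have hk2 : HasDerivWithinAt (fun θ : ℝ => ev (S ((θ • l.1, l.2)))) (l.1 • V (ev (S l)))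
          (Set.Icc 0 1) 1 := by
        have hi : HasDerivAt (fun θ : ℝ => l.2 + l.1 • ∫ τ in (0 : ℝ)..θ, extendCurve (N (S l)) τ)
            (l.1 • V (ev (S l))) 1 := by
          have hc := continuous_extendCurve (N (S l))
          have h4 := intervalIntegral.integral_hasDerivAt_right (hc.intervalIntegrable 0 1)
            (hc.stronglyMeasurableAtFilter _ _) hc.continuousAt
          have h5 : extendCurve (N (S l)) 1 = V (ev (S l)) := by
            rw [hev, ← hNV, ← extendCurve_coe]; rfl
          rw [h5] at h4
          exact (h4.const_smul l.1).const_add _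
        refine hi.hasDerivWithinAt.congr ?_ ?_
        · intro θ hθ
          rw [hev]
          exact (h1 ⟨θ, hθ⟩).trans (hfix l h2.self_of_nhds ⟨θ, hθ⟩)
        · rw [one_smul]
          exact hfix l h2.self_of_nhds 1
      have huniq := (uniqueDiffOn_Icc (zero_lt_one' ℝ) 1 (by simp)).eq_deriv _ hk.hasDerivWithinAt hk2
      have := smul_right_injective E hl huniq
      exact this ▸ hd
  · have ht : Tendsto (fun w : E => ((0 : ℂ), w)) (𝓝 w₀) (𝓝 (0, w₀)) :=
      (continuous_const.prodMk continuous_id).tendsto w₀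
    filter_upwards [ht.eventually hSeq] with w hw
    have := hfix _ hw 1
    simpa [hev] using this

end Flow

/-! ### Planar vector fields with polynomial coefficients -/

section PlanarFields

open unitInterval

/-- Curves form a Banach algebra in which `aeval` acts pointwise; this supplies smooth superposition
operators for polynomial fields. -/
theorem contDiff_aeval_curve (p : ℂ[X]) : ContDiff ℂ 1 fun z : C(I, ℂ) => aeval z p := by
  induction p using Polynomial.induction_on' with
  | add p q hp hq => simpa using hp.add hq
  | monomial n c =>
    simp only [aeval_monomial]
    fun_prop

/-- Holomorphic flow of a planar vector field, given by superposition operators for its two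
components. -/
theorem exists_planar_flow {A B : ℂ × ℂ → ℂ} {M N : C(I, ℂ) × C(I, ℂ) → C(I, ℂ)}
    (hM : ContDiff ℂ 1 M) (hN : ContDiff ℂ 1 N)
    (hMA : ∀ z θ, M z θ = A (z.1 θ, z.2 θ)) (hNB : ∀ z θ, N z θ = B (z.1 θ, z.2 θ)) (w₀ : ℂ × ℂ) :
    ∃ Φ : ℂ × (ℂ × ℂ) → ℂ × ℂ, ContDiffAt ℂ 1 Φ (0, w₀) ∧
      (∀ᶠ l in 𝓝 ((0 : ℂ), w₀), HasDerivAt (fun ζ => Φ (ζ, l.2)) (A (Φ l), B (Φ l)) l.1) ∧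
      ∀ᶠ w in 𝓝 w₀, Φ (0, w) = w := by
  let f : C(I, ℂ × ℂ) → C(I, ℂ) × C(I, ℂ) := fun z =>
    ((ContinuousLinearMap.fst ℂ ℂ ℂ).compLeftContinuous ℂ I z,
      (ContinuousLinearMap.snd ℂ ℂ ℂ).compLeftContinuous ℂ I z)
  have hf : ContDiff ℂ 1 f :=
    (ContinuousLinearMap.contDiff _).prodMk (ContinuousLinearMap.contDiff _)
  refine exists_holomorphic_flow (V := fun w => (A w, B w)) (N := fun z =>
    (ContinuousLinearMap.inl ℂ ℂ ℂ).compLeftContinuous ℂ I (M (f z)) +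
      (ContinuousLinearMap.inr ℂ ℂ ℂ).compLeftContinuous ℂ I (N (f z))) ?_ ?_ w₀
  · exact ((ContinuousLinearMap.contDiff _).comp (hM.comp hf)).add
      ((ContinuousLinearMap.contDiff _).comp (hN.comp hf))
  · intro z θ
    have h1 : (f z).1 θ = (z θ).1 := rfl
    have h2 : (f z).2 θ = (z θ).2 := rfl
    have h3 : ((ContinuousLinearMap.inl ℂ ℂ ℂ).compLeftContinuous ℂ I (M (f z))) θ =
      (M (f z) θ, 0) := rfl
    have h4 : ((ContinuousLinearMap.inr ℂ ℂ ℂ).compLeftContinuous ℂ I (N (f z))) θ =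
      (0, N (f z) θ) := rfl
    rw [ContinuousMap.add_apply, h3, h4, hMA, hNB, h1, h2]
    simp

end PlanarFields

/-! ### Local theory of the Abel equation and its first integral at infinity -/

section Abel

/-- `g` solves the Abel equation at `x`. -/
def AbelAt (p q : ℂ[X]) (g : ℂ → ℂ) (x : ℂ) : Prop :=
  HasDerivAt g (p.eval x * g x ^ 2 + q.eval x * g x ^ 3) x

theorem eq_of_hasDerivAt_zero_on_ball {g : ℂ → ℂ} {c : ℂ} {r : ℝ}
    (hg : ∀ x ∈ Metric.ball c r, HasDerivAt g 0 x) {x y : ℂ}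
    (hx : x ∈ Metric.ball c r) (hy : y ∈ Metric.ball c r) : g x = g y :=
  Metric.isOpen_ball.is_const_of_deriv_eq_zero (convex_ball c r).isPreconnected
    (fun x hx => (hg x hx).differentiableAt.differentiableWithinAt)
    (fun x hx => (hg x hx).deriv) hx hy

/-- Uniqueness for the Abel equation on a disc. -/
theorem abel_unique {p q : ℂ[X]} {g h : ℂ → ℂ} {c : ℂ} {r : ℝ}
    (hg : ∀ x ∈ Metric.ball c r, AbelAt p q g x) (hh : ∀ x ∈ Metric.ball c r, AbelAt p q h x)
    {x₁ : ℂ} (hx₁ : x₁ ∈ Metric.ball c r) (h₁ : g x₁ = h x₁) : Set.EqOn g h (Metric.ball c r) := by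
  -- The difference of the two right-hand sides is `(g - h) * K`, so `exp (-P)` with `P' = K` is an
  -- integrating factor.
  let K : ℂ → ℂ := fun x =>
    p.eval x * (g x + h x) + q.eval x * (g x ^ 2 + g x * h x + h x ^ 2)
  have hK : DifferentiableOn ℂ K (Metric.ball c r) := by
    have hgd : DifferentiableOn ℂ g (Metric.ball c r) := fun x hx =>
      (hg x hx).differentiableAt.differentiableWithinAt
    have hhd : DifferentiableOn ℂ h (Metric.ball c r) := fun x hx =>
      (hh x hx).differentiableAt.differentiableWithinAt
    have hp := p.differentiable.differentiableOn (s := Metric.ball c r)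
    have hq := q.differentiable.differentiableOn (s := Metric.ball c r)
    exact (hp.mul (hgd.add hhd)).add (hq.mul (((hgd.pow 2).add (hgd.mul hhd)).add (hhd.pow 2)))
  obtain ⟨P, hP⟩ := hK.isExactOn_ball
  have hconst : ∀ x ∈ Metric.ball c r,
      HasDerivAt (fun x => (g x - h x) * Complex.exp (-P x)) 0 x := by
    intro x hx
    have h1 := (((hg x hx).sub (hh x hx))).mul ((hP x hx).neg.cexp)
    refine h1.congr_deriv ?_
    simp only [K, Pi.sub_apply]
    ring
  intro x hx
  have h2 := eq_of_hasDerivAt_zero_on_ball hconst hx hx₁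
  simp only [h₁, sub_self, zero_mul, mul_eq_zero, Complex.exp_ne_zero, or_false] at h2
  exact sub_eq_zero.1 h2

theorem abel_unique_germ {p q : ℂ[X]} {g h : ℂ → ℂ} {c : ℂ} (hg : ∀ᶠ x in 𝓝 c, AbelAt p q g x)
    (hh : ∀ᶠ x in 𝓝 c, AbelAt p q h x) (h₁ : g c = h c) : g =ᶠ[𝓝 c] h := by
  obtain ⟨r, hr, hball⟩ := Metric.eventually_nhds_iff_ball.1 (hg.and hh)
  exact (abel_unique (fun x hx => (hball x hx).1) (fun x hx => (hball x hx).2)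
    (Metric.mem_ball_self hr) h₁).eventuallyEq_of_mem (Metric.ball_mem_nhds c hr)

/-- Local solvability of the Abel equation, uniform in the initial point and value, with holomorphic
dependence on the initial value. -/
theorem exists_abel_local (p q : ℂ[X]) (x₀ y₀ : ℂ) :
    ∃ r > 0, ∃ Y : ℂ → ℂ → ℂ → ℂ, ∀ x₁ ∈ Metric.ball x₀ r, ∀ y₁ ∈ Metric.ball y₀ r,
      Y x₁ y₁ x₁ = y₁ ∧ ∀ x ∈ Metric.ball x₀ r, AbelAt p q (Y x₁ y₁) x ∧
        ∃ d ≠ 0, HasDerivAt (fun y => Y x₁ y x) d y₁ := by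
  obtain ⟨Φ, hΦ, hode, h0⟩ := exists_planar_flow (A := fun _ => 1)
    (B := fun w => p.eval w.1 * w.2 ^ 2 + q.eval w.1 * w.2 ^ 3) (M := fun _ => 1)
    (N := fun z => aeval z.1 p * z.2 ^ 2 + aeval z.1 q * z.2 ^ 3) contDiff_const
    (by
      have h1 := (contDiff_aeval_curve p).comp (contDiff_fst (𝕜 := ℂ) (n := 1)
        (E := C(unitInterval, ℂ)) (F := C(unitInterval, ℂ)))
      have h2 := (contDiff_aeval_curve q).comp (contDiff_fst (𝕜 := ℂ) (n := 1)
        (E := C(unitInterval, ℂ)) (F := C(unitInterval, ℂ)))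
      exact (h1.mul (contDiff_snd.pow 2)).add (h2.mul (contDiff_snd.pow 3)))
    (fun _ _ => rfl) (fun z θ => by simp) (x₀, y₀)
  have hd : ∀ᶠ l in 𝓝 ((0 : ℂ), (x₀, y₀)), DifferentiableAt ℂ Φ l :=
    (hΦ.eventually (by simp)).mono fun l hl => hl.differentiableAt one_ne_zero
  -- At time `0` the flow is the identity and this derivative is `1`; continuity does the rest.
  have hne : ∀ᶠ l in 𝓝 ((0 : ℂ), (x₀, y₀)), (fderiv ℂ Φ l (0, (0, 1))).2 ≠ 0 := by
    have hc : ContinuousAt (fun l => (fderiv ℂ Φ l (0, (0, 1))).2) (0, (x₀, y₀)) := by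
      have := hΦ.continuousAt_fderiv one_ne_zero
      fun_prop
    refine hc.eventually_ne ?_
    have h1 : HasDerivAt (fun y => Φ (0, (x₀, y))) (fderiv ℂ Φ (0, (x₀, y₀)) (0, (0, 1))) y₀ := by
      have hin : HasDerivAt (fun y => ((0 : ℂ), (x₀, y))) (0, (0, 1)) y₀ :=
        (hasDerivAt_const _ _).prodMk ((hasDerivAt_const _ _).prodMk (hasDerivAt_id _))
      exact (hΦ.differentiableAt one_ne_zero).hasFDerivAt.comp_hasDerivAt y₀ hin
    have h2 : HasDerivAt (fun y => Φ (0, (x₀, y))) (0, 1) y₀ := by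
      have hin : HasDerivAt (fun y => (x₀, y)) ((0 : ℂ), (1 : ℂ)) y₀ :=
        (hasDerivAt_const _ _).prodMk (hasDerivAt_id _)
      refine hin.congr_of_eventuallyEq ?_
      have ht : Tendsto (fun y : ℂ => (x₀, y)) (𝓝 y₀) (𝓝 (x₀, y₀)) :=
        (continuous_const.prodMk continuous_id).tendsto y₀
      exact ht.eventually h0
    rw [h1.unique h2]
    exact one_ne_zero
  obtain ⟨ε, hε, hball⟩ := Metric.eventually_nhds_iff_ball.1 (hode.and (hd.and hne))
  obtain ⟨ε', hε', hball'⟩ := Metric.eventually_nhds_iff_ball.1 h0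
  have hmem : ∀ ζ x y : ℂ, ‖ζ‖ < ε → ‖x - x₀‖ < ε → ‖y - y₀‖ < ε →
      (ζ, (x, y)) ∈ Metric.ball ((0 : ℂ), (x₀, y₀)) ε := by
    intro ζ x y h1 h2 h3
    simp only [Metric.mem_ball, dist_eq_norm, Prod.norm_def, Prod.fst_sub, Prod.snd_sub, sub_zero,
      max_lt_iff]
    exact ⟨h1, h2, h3⟩
  -- The first component of the field is `1`, so time is `x - x₁`; the radius `ε / 2` keeps it below
  -- `ε` in norm.
  refine ⟨min (ε / 2) ε', by positivity, fun x₁ y₁ x => (Φ (x - x₁, (x₁, y₁))).2, ?_⟩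
  intro x₁ hx₁ y₁ hy₁
  rw [Metric.mem_ball, dist_eq_norm, lt_min_iff] at hx₁ hy₁
  have hini : Φ (0, (x₁, y₁)) = (x₁, y₁) := by
    refine hball' _ ?_
    simp only [Metric.mem_ball, dist_eq_norm, Prod.norm_def, Prod.fst_sub, Prod.snd_sub,
      max_lt_iff]
    exact ⟨hx₁.2, hy₁.2⟩
  refine ⟨by simp [hini], fun x hx => ?_⟩
  rw [Metric.mem_ball, dist_eq_norm, lt_min_iff] at hx
  have hxx : ‖x - x₁‖ < ε := by
    have := norm_sub_le (x - x₀) (x₁ - x₀)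
    rw [sub_sub_sub_cancel_right] at this
    linarith [hx.1, hx₁.1]
  have hm : ∀ ζ ∈ Metric.ball (0 : ℂ) ε, (ζ, (x₁, y₁)) ∈ Metric.ball ((0 : ℂ), (x₀, y₀)) ε := by
    intro ζ hζ
    exact hmem _ _ _ (by simpa using hζ) (by linarith [hx₁.1]) (by linarith [hy₁.1])
  have hfst : ∀ ζ ∈ Metric.ball (0 : ℂ) ε, (Φ (ζ, (x₁, y₁))).1 = x₁ + ζ := by
    intro ζ hζ
    have h1 : ∀ ζ ∈ Metric.ball (0 : ℂ) ε,
        HasDerivAt (fun ζ => (Φ (ζ, (x₁, y₁))).1 - ζ) 0 ζ := by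
      intro ζ hζ
      have := (hball _ (hm ζ hζ)).1
      have h2 := ((ContinuousLinearMap.fst ℂ ℂ ℂ).hasFDerivAt.comp_hasDerivAt ζ this).sub
        (hasDerivAt_id ζ)
      refine h2.congr_deriv ?_
      simp
    have h3 := eq_of_hasDerivAt_zero_on_ball h1 hζ (Metric.mem_ball_self hε)
    simp only [hini, sub_zero] at h3
    linear_combination h3
  have hxb : x - x₁ ∈ Metric.ball (0 : ℂ) ε := by simpa using hxx
  constructor
  · have h1 := (hball _ (hm _ hxb)).1
    have h2 := (ContinuousLinearMap.snd ℂ ℂ ℂ).hasFDerivAt.comp_hasDerivAt (x - x₁) h1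
    have h3 := h2.comp_sub_const x x₁
    refine h3.congr_deriv ?_
    simp only [ContinuousLinearMap.coe_snd', hfst _ hxb]
    ring_nf
  · have h1 := (hball _ (hm _ hxb)).2
    refine ⟨_, h1.2, ?_⟩
    have hin : HasDerivAt (fun y => (x - x₁, (x₁, y))) (0, (0, 1)) y₁ :=
      (hasDerivAt_const _ _).prodMk ((hasDerivAt_const _ _).prodMk (hasDerivAt_id _))
    exact (ContinuousLinearMap.snd ℂ ℂ ℂ).hasFDerivAt.comp_hasDerivAt y₁
      (h1.1.hasFDerivAt.comp_hasDerivAt y₁ hin)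

/-- In the coordinate `u = 1 / y`, the solutions of the Abel equation near a point `(b, 0)` with
`q b ≠ 0` are the level sets of a holomorphic function `C` with `C (x, 0) = x`. -/
theorem exists_firstIntegral (p q : ℂ[X]) {b : ℂ} (hb : q.eval b ≠ 0) :
    ∃ C : ℂ × ℂ → ℂ, ContDiffAt ℂ 1 C (b, 0) ∧ (∀ᶠ x in 𝓝 b, C (x, 0) = x) ∧
      ∀ᶠ m in 𝓝 (b, (0 : ℂ)), fderiv ℂ C m (-m.2, p.eval m.1 * m.2 + q.eval m.1) = 0 := by
  obtain ⟨Φ, hΦ, hode, h0⟩ := exists_planar_flow (A := fun w => -w.2)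
    (B := fun w => p.eval w.1 * w.2 + q.eval w.1) (M := fun z => -z.2)
    (N := fun z => aeval z.1 p * z.2 + aeval z.1 q) contDiff_snd.neg
    (by
      have h1 := (contDiff_aeval_curve p).comp (contDiff_fst (𝕜 := ℂ) (n := 1)
        (E := C(unitInterval, ℂ)) (F := C(unitInterval, ℂ)))
      have h2 := (contDiff_aeval_curve q).comp (contDiff_fst (𝕜 := ℂ) (n := 1)
        (E := C(unitInterval, ℂ)) (F := C(unitInterval, ℂ)))
      exact (h1.mul contDiff_snd).add h2)
    (fun _ _ => rfl) (fun z θ => by simp) (b, 0)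
  have hx0 : Tendsto (fun x : ℂ => (x, (0 : ℂ))) (𝓝 b) (𝓝 (b, 0)) :=
    (continuous_id.prodMk continuous_const).tendsto b
  -- `R (ζ, c)` flows for time `ζ` from the point `(c, 0)` of the transversal `u = 0`. The first
  -- integral is the second component of the local inverse of `R`.
  let R : ℂ × ℂ → ℂ × ℂ := fun v => Φ (v.1, (v.2, 0))
  have hin : ContDiff ℂ 1 fun v : ℂ × ℂ => (v.1, (v.2, (0 : ℂ))) := by fun_prop
  have hR : ContDiffAt ℂ 1 R (0, b) :=
    ContDiffAt.comp (g := Φ) (f := fun v : ℂ × ℂ => (v.1, (v.2, (0 : ℂ)))) (0, b) hΦ hin.contDiffAt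
  have hR0 : R (0, b) = (b, 0) := h0.self_of_nhds
  let e : (ℂ × ℂ) ≃L[ℂ] ℂ × ℂ := (ContinuousLinearEquiv.prodComm ℂ ℂ ℂ).trans
    ((ContinuousLinearEquiv.refl ℂ ℂ).prodCongr
      (ContinuousLinearEquiv.unitsEquivAut ℂ (Units.mk0 _ hb)))
  have he : ∀ v, e v = (v.2, v.1 * q.eval b) := fun v => rfl
  have hR' : HasFDerivAt R (e : (ℂ × ℂ) →L[ℂ] ℂ × ℂ) (0, b) := by
    have h1 := (hR.differentiableAt one_ne_zero).hasFDerivAt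
    refine h1.congr_fderiv ?_
    have ha : HasDerivAt (fun ζ => R (ζ, b)) (fderiv ℂ R (0, b) (1, 0)) 0 :=
      HasFDerivAt.comp_hasDerivAt (l := R) (f := fun ζ => (ζ, b)) (0 : ℂ) h1 ((hasDerivAt_id (0 : ℂ)).prodMk (hasDerivAt_const _ _))
    have ha' : HasDerivAt (fun ζ => R (ζ, b)) (0, q.eval b) 0 := by
      have := hode.self_of_nhds
      simpa [h0.self_of_nhds] using this
    have hc : HasDerivAt (fun c => R (0, c)) (fderiv ℂ R (0, b) (0, 1)) b :=
      HasFDerivAt.comp_hasDerivAt (l := R) (f := fun c => (0, c)) b h1 ((hasDerivAt_const _ _).prodMk (hasDerivAt_id b))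
    have hc' : HasDerivAt (fun c => R (0, c)) (1, 0) b :=
      HasDerivAt.congr_of_eventuallyEq
        ((hasDerivAt_id b).prodMk (hasDerivAt_const b (0 : ℂ))) (hx0.eventually h0)
    ext <;> simp [ha.unique ha', hc.unique hc', he]
  let L := hR.toOpenPartialHomeomorph R hR' one_ne_zero
  have hLs : (0, b) ∈ L.source := hR.mem_toOpenPartialHomeomorph_source hR' one_ne_zero
  have hLt : (b, 0) ∈ L.target := hR0 ▸ hR.image_mem_toOpenPartialHomeomorph_target hR' one_ne_zero
  have hLc : ⇑L = R := rfl
  have hinvc : ContDiffAt ℂ 1 L.symm (b, 0) := by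
    have := hR.to_localInverse hR' one_ne_zero
    rw [hR0] at this
    exact this
  have hinv0 : L.symm (b, 0) = (0, b) := by
    have := L.left_inv hLs
    rwa [hLc, hR0] at this
  have hC : ContDiffAt ℂ 1 (fun m => (L.symm m).2) (b, 0) := contDiffAt_snd.comp _ hinvc
  refine ⟨fun m => (L.symm m).2, hC, ?_, ?_⟩
  · have hs : Tendsto (fun x : ℂ => ((0 : ℂ), x)) (𝓝 b) (𝓝 (0, b)) :=
      (continuous_const.prodMk continuous_id).tendsto b
    filter_upwards [hx0.eventually h0, hs.eventually (L.open_source.mem_nhds hLs)] with x h1 h2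
    have h3 := L.left_inv h2
    rw [hLc] at h3
    simp only [R, h1] at h3
    rw [h3]
  · have ht : Tendsto L.symm (𝓝 (b, 0)) (𝓝 (0, b)) := by
      have := hinvc.continuousAt.tendsto
      rwa [hinv0] at this
    have hode' : ∀ᶠ v in 𝓝 ((0 : ℂ), b), HasDerivAt (fun ζ => R (ζ, v.2))
        (-(R v).2, p.eval (R v).1 * (R v).2 + q.eval (R v).1) v.1 := by
      have : Tendsto (fun v : ℂ × ℂ => (v.1, (v.2, (0 : ℂ)))) (𝓝 (0, b)) (𝓝 (0, (b, 0))) :=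
        hin.continuous.tendsto (0, b)
      exact this.eventually hode
    have hCd : ∀ᶠ m in 𝓝 (b, (0 : ℂ)), DifferentiableAt ℂ (fun m => (L.symm m).2) m :=
      (hC.eventually (by simp)).mono fun l hl => hl.differentiableAt one_ne_zero
    filter_upwards [ht.eventually hode', hCd, L.open_target.mem_nhds hLt] with m h1 h2 h3
    have hRm : R (L.symm m) = m := L.right_inv h3
    rw [hRm] at h1
    have h4 : HasDerivAt (fun ζ => (L.symm (R (ζ, (L.symm m).2))).2)
        (fderiv ℂ (fun m => (L.symm m).2) m (-m.2, p.eval m.1 * m.2 + q.eval m.1))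
        (L.symm m).1 := by
      have h5 : HasFDerivAt (fun m => (L.symm m).2) (fderiv ℂ (fun m => (L.symm m).2) m)
          (R ((L.symm m).1, (L.symm m).2)) := by
        rw [Prod.mk.eta, hRm]; exact h2.hasFDerivAt
      exact HasFDerivAt.comp_hasDerivAt (l := fun m => (L.symm m).2)
        (f := fun ζ => R (ζ, (L.symm m).2)) (L.symm m).1 h5 h1
    have h6 : HasDerivAt (fun ζ => (L.symm (R (ζ, (L.symm m).2))).2) 0 (L.symm m).1 := by
      refine (hasDerivAt_const _ ((L.symm m).2)).congr_of_eventuallyEq ?_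
      have hs : Tendsto (fun ζ : ℂ => (ζ, (L.symm m).2)) (𝓝 (L.symm m).1) (𝓝 (L.symm m)) :=
        (continuous_id.prodMk continuous_const).tendsto (L.symm m).1
      filter_upwards [hs.eventually (L.open_source.mem_nhds (L.map_target h3))] with ζ hζ
      have := L.left_inv hζ
      rw [hLc] at this
      rw [this]
    exact h4.unique h6

end Abel

/-! ### Continuation of solutions along the path and dependence on the initial value -/

section Continuation

open unitInterval

/-- Induction along an interval: a property that propagates to the right over short intervals
holds from `t₀` on. -/
theorem unitInterval_induction {P : I → Prop} {J : Set I} (hJ : J.OrdConnected) {t₀ : I}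
    (ht₀ : t₀ ∈ J) (h₀ : P t₀)
    (hloc : ∀ t ∈ J, ∃ U ∈ 𝓝[J] t, ∀ t₁ ∈ J, ∀ t₂ ∈ J, t₁ ≤ t₂ → Set.Icc t₁ t₂ ⊆ U → P t₁ → P t₂)
    {t : I} (ht : t ∈ J) (h : t₀ ≤ t) : P t := by
  have hsub : Set.Icc t₀ t ⊆ J := hJ.out ht₀ ht
  let T : Set I := {x | x ∈ Set.Icc t₀ t ∧ P x}
  have hT₀ : t₀ ∈ T := ⟨⟨le_rfl, h⟩, h₀⟩
  -- Points of `T` close to `c` carry the property to `c`; were `c < t`, it would pass beyond `c`,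
  -- against maximality.
  obtain ⟨c, hc⟩ := isClosed_closure.isCompact.exists_isGreatest (s := closure T)
    ⟨t₀, subset_closure hT₀⟩
  have hcI : c ∈ Set.Icc t₀ t := closure_minimal (fun x hx => hx.1) isClosed_Icc hc.1
  obtain ⟨U, hU, hprop⟩ := hloc c (hsub hcI)
  obtain ⟨V, hV, hVU⟩ := mem_nhdsWithin_iff_exists_mem_nhds_inter.1 hU
  obtain ⟨l, u, hlu, hnhds, hV'⟩ := exists_Icc_mem_subset_of_mem_nhds hV
  have hprop' : ∀ x ∈ Set.Icc l u, ∀ y ∈ Set.Icc l u, x ∈ J → y ∈ J → x ≤ y → P x → P y := by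
    intro x hx y hy hxJ hyJ hxy
    refine hprop x hxJ y hyJ hxy fun z hz => hVU ⟨hV' ?_, hJ.out hxJ hyJ hz⟩
    exact ⟨hx.1.trans hz.1, hz.2.trans hy.2⟩
  obtain ⟨x, hxU, hxT⟩ := mem_closure_iff_nhds.1 hc.1 _ hnhds
  have hPc : P c := hprop' x hxU c hlu (hsub hxT.1) (hsub hcI) (hc.2 (subset_closure hxT)) hxT.2
  rcases hcI.2.eq_or_lt with hct | hct
  · exact hct ▸ hPc
  · have : (𝓝[>] c).NeBot := nhdsGT_neBot_of_exists_gt ⟨t, hct⟩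
    obtain ⟨y, hyU, hy⟩ := (inter_mem (mem_nhdsWithin_of_mem_nhds hnhds) (Ioc_mem_nhdsGT hct) :
      Set.Icc l u ∩ Set.Ioc c t ∈ 𝓝[>] c) |> Filter.nonempty_of_mem
    have hyI : y ∈ Set.Icc t₀ t := ⟨hcI.1.trans hy.1.le, hy.2⟩
    have hyT : y ∈ T := ⟨hyI, hprop' c hlu y hyU (hsub hcI) (hsub hyI) hy.1.le hPc⟩
    exact absurd (hc.2 (subset_closure hyT)) (not_le.2 hy.1)

variable {p q : ℂ[X]} {a b : ℂ} {s : Path a b}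

theorem analyticOnNhd_of_abelAt {g : ℂ → ℂ} {c : ℂ} {r : ℝ}
    (hg : ∀ x ∈ Metric.ball c r, AbelAt p q g x) : AnalyticOnNhd ℂ g (Metric.ball c r) :=
  DifferentiableOn.analyticOnNhd
    (fun x hx => (hg x hx).differentiableAt.differentiableWithinAt) Metric.isOpen_ball

theorem abelAt_congr {f g : ℂ → ℂ} {x : ℂ} (h : f =ᶠ[𝓝 x] g) (hf : AbelAt p q f x) :
    AbelAt p q g x := by
  rw [AbelAt, ← h.eq_of_nhds]
  exact hf.congr_of_eventuallyEq h.symm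

theorem eventually_abelAt_congr {f g : ℂ → ℂ} {x : ℂ} (h : f =ᶠ[𝓝 x] g)
    (hf : ∀ᶠ z in 𝓝 x, AbelAt p q f z) : ∀ᶠ z in 𝓝 x, AbelAt p q g z := by
  filter_upwards [h.eventuallyEq_nhds, hf] with z h1 h2 using abelAt_congr h1 h2

/-- An analytic function that solves the Abel equation near points arbitrarily close to `c` solves
it near `c`. -/
theorem AnalyticAt.eventually_abelAt_of_frequently {g : ℂ → ℂ} {c : ℂ} (hg : AnalyticAt ℂ g c) :
    ∀ᶠ x in 𝓝 c, (∀ᶠ z in 𝓝 x, AbelAt p q g z) → ∀ᶠ z in 𝓝 c, AbelAt p q g z := by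
  obtain ⟨r, hr, hball⟩ := Metric.eventually_nhds_iff_ball.1 hg.eventually_analyticAt
  have hgA : AnalyticOnNhd ℂ g (Metric.ball c r) := hball
  filter_upwards [Metric.ball_mem_nhds c hr] with x hx hx'
  have hp : AnalyticOnNhd ℂ (fun x => p.eval x) (Metric.ball c r) :=
    p.differentiable.differentiableOn.analyticOnNhd Metric.isOpen_ball
  have hq : AnalyticOnNhd ℂ (fun x => q.eval x) (Metric.ball c r) :=
    q.differentiable.differentiableOn.analyticOnNhd Metric.isOpen_ball
  have hEq := hgA.deriv.eqOn_of_preconnected_of_eventuallyEq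
    ((hp.mul (hgA.pow 2)).add (hq.mul (hgA.pow 3))) (convex_ball c r).isPreconnected hx
    (hx'.mono fun z hz => HasDerivAt.deriv hz)
  filter_upwards [Metric.ball_mem_nhds c hr] with z hz
  have := (hgA z hz).differentiableAt.hasDerivAt
  rw [hEq hz] at this
  exact this

theorem IsContinuationAlong.tendsto_value {J : Set I} {f : I → ℂ → ℂ}
    (hf : IsContinuationAlong s J f) {t : I} (ht : t ∈ J) :
    Tendsto (fun t' => f t' (s t')) (𝓝[J] t) (𝓝 (f t (s t))) := by
  have h1 : Tendsto (fun t' => f t (s t')) (𝓝[J] t) (𝓝 (f t (s t))) :=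
    (hf.analyticAt t ht).continuousAt.tendsto.comp
      (s.continuous.continuousAt.tendsto.mono_left nhdsWithin_le_nhds)
  refine h1.congr' ?_
  filter_upwards [hf.compatible t ht] with t' h using h.eq_of_nhds.symm

/-- The continued function elements all solve the Abel equation. -/
theorem IsContinuationAlong.eventually_abelAt {J : Set I} {f : I → ℂ → ℂ} {w : ℂ}
    (hJ : J.OrdConnected) (h0J : 0 ∈ J) (h0 : IsAbelSolutionGerm p q a w (f 0))
    (hf : IsContinuationAlong s J f) {t : I} (ht : t ∈ J) :
    ∀ᶠ x in 𝓝 (s t), AbelAt p q (f t) x := by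
  -- The induction needs both directions between neighbouring parameters: passing from `t` to `t'`
  -- is restriction, passing back is the identity theorem.
  refine hJ.isPreconnected.induction₂' (fun t t' => (∀ᶠ x in 𝓝 (s t), AbelAt p q (f t) x) →
    ∀ᶠ x in 𝓝 (s t'), AbelAt p q (f t') x) ?_ ?_ h0J ht ?_
  · intro t ht
    have hst : Tendsto s (𝓝[J] t) (𝓝 (s t)) :=
      s.continuous.continuousAt.tendsto.mono_left nhdsWithin_le_nhds
    filter_upwards [hf.compatible t ht,
      hst.eventually ((hf.analyticAt t ht).eventually_abelAt_of_frequently (p := p) (q := q)),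
      hst.eventually (eventually_imp_distrib_left.2 fun h =>
        (eventually_eventually_nhds (p := fun x => AbelAt p q (f t) x)).2 h)] with t' h1 h2 h3
    exact ⟨fun h => eventually_abelAt_congr h1.symm (h3 h),
      fun h => h2 (eventually_abelAt_congr h1 h)⟩
  · intro x y z _ _ _ h1 h2 h3
    exact h2 (h1 h3)
  · rw [s.source]; exact h0.2

/-- Gluing a holomorphic function on an open set to a continuation along an initial part of `s`. -/
theorem IsContinuationAlong.glue {f : I → ℂ → ℂ} {g : ℂ → ℂ} {τ τ' : I}
    (hf : IsContinuationAlong s (Set.Iic τ) f) {U : Set ℂ} (hg : AnalyticOnNhd ℂ g U)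
    (hsU : ∀ t ∈ Set.Icc τ τ', s t ∈ U) (hfg : f τ =ᶠ[𝓝 (s τ)] g) :
    IsContinuationAlong s (Set.Iic τ') (fun t => if t < τ then f t else g) where
  analyticAt t ht := by
    by_cases h : t < τ
    · simpa [h] using hf.analyticAt t h.le
    · simpa [h] using hg _ (hsU t ⟨not_lt.1 h, ht⟩)
  compatible t ht := by
    rcases lt_trichotomy t τ with h | h | h
    · have h1 := eventually_nhdsWithin_iff.1 (hf.compatible t h.le)
      filter_upwards [mem_nhdsWithin_of_mem_nhds h1,
        mem_nhdsWithin_of_mem_nhds (Iio_mem_nhds h)] with t' h2 h3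
      rw [if_pos h, if_pos (Set.mem_Iio.1 h3)]
      exact h2 (Set.mem_Iio.1 h3).le
    · subst h
      have h1 := eventually_nhdsWithin_iff.1 (hf.compatible t Set.self_mem_Iic)
      have h4 := (s.continuous.tendsto t).eventually hfg.eventuallyEq_nhds
      filter_upwards [mem_nhdsWithin_of_mem_nhds h1, mem_nhdsWithin_of_mem_nhds h4] with t' h2 h3
      rw [if_neg (lt_irrefl t)]
      split_ifs with h5
      · exact (h2 h5.le).trans h3
      · rfl
    · filter_upwards [mem_nhdsWithin_of_mem_nhds (Ioi_mem_nhds h)] with t' h2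
      rw [if_neg h.not_gt, if_neg (Set.mem_Ioi.1 h2).not_gt]

/-- Extending a continued Abel solution by a solution on a disc. -/
theorem exists_abel_extension {f : I → ℂ → ℂ} {g : ℂ → ℂ} {τ τ' : I} {w c : ℂ} {r : ℝ}
    (h0 : IsAbelSolutionGerm p q a w (f 0)) (hf : IsContinuationAlong s (Set.Iic τ) f)
    (hττ' : τ ≤ τ') (hg : ∀ x ∈ Metric.ball c r, AbelAt p q g x)
    (hs : ∀ t ∈ Set.Icc τ τ', s t ∈ Metric.ball c r) (hfg : f τ (s τ) = g (s τ)) :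
    ∃ F : I → ℂ → ℂ, IsAbelSolutionGerm p q a w (F 0) ∧ IsContinuationAlong s (Set.Iic τ') F ∧
      F τ' = g := by
  have hsτ := hs τ ⟨le_rfl, hττ'⟩
  have hgerm : f τ =ᶠ[𝓝 (s τ)] g :=
    abel_unique_germ (hf.eventually_abelAt Set.ordConnected_Iic unitInterval.nonneg' h0 Set.self_mem_Iic)
      (eventually_of_mem (Metric.isOpen_ball.mem_nhds hsτ) hg) hfg
  refine ⟨_, ?_, hf.glue (analyticOnNhd_of_abelAt hg) hs hgerm, if_neg hττ'.not_gt⟩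
  by_cases h : 0 < τ
  · rwa [if_pos h]
  · rw [if_neg h]
    obtain rfl : τ = 0 := le_antisymm (not_lt.1 h) bot_le
    rw [s.source] at hgerm
    exact ⟨hgerm.eq_of_nhds ▸ h0.1, eventually_abelAt_congr hgerm h0.2⟩

theorem IsContinuationAlong.mono {J J' : Set I} {f : I → ℂ → ℂ} (hf : IsContinuationAlong s J f)
    (h : J' ⊆ J) : IsContinuationAlong s J' f where
  analyticAt t ht := hf.analyticAt t (h ht)
  compatible t ht := (hf.compatible t (h ht)).filter_mono (nhdsWithin_mono _ h)

/-- Solutions with nearby initial values can be continued as far as a given one, and the value at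
the end depends holomorphically, with nonzero derivative, on the initial value. -/
theorem exists_abel_transport {f : I → ℂ → ℂ} {w₀ : ℂ} {J : Set I} (hJ : J.OrdConnected)
    (h0J : 0 ∈ J) (h0 : IsAbelSolutionGerm p q a w₀ (f 0)) (hf : IsContinuationAlong s J f)
    {τ : I} (hτ : τ ∈ J) :
    ∃ T : ℂ → ℂ, AnalyticAt ℂ T w₀ ∧ deriv T w₀ ≠ 0 ∧ T w₀ = f τ (s τ) ∧
      ∀ᶠ w in 𝓝 w₀, ∃ F : I → ℂ → ℂ, IsAbelSolutionGerm p q a w (F 0) ∧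
        IsContinuationAlong s (Set.Iic τ) F ∧ F τ (s τ) = T w := by
  refine unitInterval_induction hJ h0J (P := fun τ => ∃ T : ℂ → ℂ, AnalyticAt ℂ T w₀ ∧
    deriv T w₀ ≠ 0 ∧ T w₀ = f τ (s τ) ∧ ∀ᶠ w in 𝓝 w₀, ∃ F : I → ℂ → ℂ,
      IsAbelSolutionGerm p q a w (F 0) ∧ IsContinuationAlong s (Set.Iic τ) F ∧
        F τ (s τ) = T w) ?_ ?_ hτ bot_le
  · refine ⟨id, analyticAt_id, by simp, by rw [s.source]; exact h0.1.symm, ?_⟩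
    obtain ⟨r, hr, Y, hY⟩ := exists_abel_local p q a w₀
    filter_upwards [Metric.ball_mem_nhds w₀ hr] with w hw
    have h1 := hY a (Metric.mem_ball_self hr) w hw
    refine ⟨fun _ => Y a w, ⟨h1.1, eventually_of_mem (Metric.ball_mem_nhds a hr)
      fun x hx => (h1.2 x hx).1⟩, ⟨fun t ht => ?_, fun t _ => ?_⟩, ?_⟩
    · obtain rfl : t = 0 := le_antisymm ht bot_le
      rw [s.source]
      exact analyticOnNhd_of_abelAt (fun x hx => (h1.2 x hx).1) _ (Metric.mem_ball_self hr)
    · exact Eventually.of_forall fun _ => EventuallyEq.rfl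
    · rw [s.source]; exact h1.1
  · intro t ht
    obtain ⟨r, hr, Y, hY⟩ := exists_abel_local p q (s t) (f t (s t))
    obtain ⟨ρ, hρ, hfρ⟩ := Metric.eventually_nhds_iff_ball.1 (hf.eventually_abelAt hJ h0J h0 ht)
    have hm : 0 < min r ρ := lt_min hr hρ
    have hst : Tendsto s (𝓝[J] t) (𝓝 (s t)) :=
      s.continuous.continuousAt.tendsto.mono_left nhdsWithin_le_nhds
    refine ⟨_, (hf.compatible t ht).and ((hst.eventually (Metric.ball_mem_nhds _ hm)).and
      ((hf.tendsto_value ht).eventually (Metric.ball_mem_nhds _ hr))), ?_⟩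
    rintro t₁ - t₂ - h12 hsub ⟨T, hTa, hTd, hT0, hTF⟩
    obtain ⟨h1c, h1s, h1v⟩ := hsub (Set.left_mem_Icc.2 h12)
    obtain ⟨h2c, h2s, h2v⟩ := hsub (Set.right_mem_Icc.2 h12)
    have hbr : Metric.ball (s t) (min r ρ) ⊆ Metric.ball (s t) r :=
      Metric.ball_subset_ball (min_le_left _ _)
    have hbρ : Metric.ball (s t) (min r ρ) ⊆ Metric.ball (s t) ρ :=
      Metric.ball_subset_ball (min_le_right _ _)
    have hY1 := hY (s t₁) (hbr h1s)
    have hTw : T w₀ ∈ Metric.ball (f t (s t)) r := by rw [hT0]; exact h1v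
    have hdiff : AnalyticAt ℂ (fun y => Y (s t₁) y (s t₂)) (T w₀) := by
      refine DifferentiableOn.analyticAt (s := Metric.ball (f t (s t)) r) (fun y hy => ?_)
        (Metric.isOpen_ball.mem_nhds hTw)
      obtain ⟨d, -, hd⟩ := ((hY1 y hy).2 _ (hbr h2s)).2
      exact hd.differentiableAt.differentiableWithinAt
    obtain ⟨d, hd0, hd⟩ := ((hY1 _ hTw).2 _ (hbr h2s)).2
    -- The transport map up to `t₂` is the one up to `t₁` followed by the local solution map, whose
    -- derivative is nonzero.
    refine ⟨fun w => Y (s t₁) (T w) (s t₂), hdiff.comp hTa, ?_, ?_, ?_⟩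
    · have := HasDerivAt.comp w₀ hd hTa.differentiableAt.hasDerivAt
      have h3 : deriv (fun w => Y (s t₁) (T w) (s t₂)) w₀ = d * deriv T w₀ := this.deriv
      rw [h3]
      exact mul_ne_zero hd0 hTd
    · have h3 := abel_unique (fun x hx => ((hY1 _ hTw).2 x (hbr hx)).1)
        (fun x hx => hfρ x (hbρ hx)) h1s
        (by rw [(hY1 _ hTw).1, hT0]; exact h1c.eq_of_nhds)
      exact (h3 h2s).trans h2c.eq_of_nhds.symm
    · filter_upwards [hTF, hTa.continuousAt.tendsto.eventually
        (Metric.isOpen_ball.mem_nhds hTw)] with w ⟨F, hF0, hF, hFT⟩ hw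
      obtain ⟨F', h1, h2, h3⟩ := exists_abel_extension hF0 hF h12
        (fun x hx => ((hY1 _ hw).2 x hx).1) (fun t' ht' => hbr (hsub ht').2.1)
        (by rw [hFT, (hY1 _ hw).1])
      exact ⟨F', h1, h2, by rw [h3]⟩

end Continuation

/-! ### Blow-up at the endpoint and levels of the first integral -/

section Blowup

open unitInterval

variable {p q : ℂ[X]} {a b : ℂ} {s : Path a b}

/-- The radius of existence of solutions of the Abel equation is bounded below on compact sets of
initial data. -/
theorem exists_uniform_abel_radius (p q : ℂ[X]) {K : Set (ℂ × ℂ)} (hK : IsCompact K) :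
    ∃ ρ > 0, ∀ m ∈ K, ∃ g : ℂ → ℂ, g m.1 = m.2 ∧ ∀ x ∈ Metric.ball m.1 ρ, AbelAt p q g x := by
  refine hK.induction_on (p := fun K => ∃ ρ > 0, ∀ m ∈ K, ∃ g : ℂ → ℂ, g m.1 = m.2 ∧
    ∀ x ∈ Metric.ball m.1 ρ, AbelAt p q g x) ?_ ?_ ?_ ?_
  · exact ⟨1, one_pos, by simp⟩
  · rintro S S' hSS' ⟨ρ, hρ, h⟩
    exact ⟨ρ, hρ, fun m hm => h m (hSS' hm)⟩
  · rintro S S' ⟨ρ, hρ, h⟩ ⟨ρ', hρ', h'⟩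
    refine ⟨min ρ ρ', lt_min hρ hρ', ?_⟩
    rintro m (hm | hm)
    · obtain ⟨g, hg, hgb⟩ := h m hm
      exact ⟨g, hg, fun x hx => hgb x (Metric.ball_subset_ball (min_le_left _ _) hx)⟩
    · obtain ⟨g, hg, hgb⟩ := h' m hm
      exact ⟨g, hg, fun x hx => hgb x (Metric.ball_subset_ball (min_le_right _ _) hx)⟩
  · intro m _
    obtain ⟨r, hr, Y, hY⟩ := exists_abel_local p q m.1 m.2
    refine ⟨Metric.ball m (r / 2), mem_nhdsWithin_of_mem_nhds (Metric.ball_mem_nhds _ (by positivity)),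
      r / 2, by positivity, fun m' hm' => ?_⟩
    rw [Metric.mem_ball, Prod.dist_eq, max_lt_iff] at hm'
    have h := hY m'.1 (Metric.mem_ball.2 (by linarith [hm'.1])) m'.2
      (Metric.mem_ball.2 (by linarith [hm'.2]))
    refine ⟨Y m'.1 m'.2, h.1, fun x hx => (h.2 x ?_).1⟩
    rw [Metric.mem_ball] at hx ⊢
    linarith [dist_triangle x m'.1 m.1, hm'.1]

theorem Path.exists_lt_one_forall_mem (s : Path a b) {U : Set ℂ} (hU : U ∈ 𝓝 b) :
    ∃ t₀ < 1, ∀ t ∈ Set.Icc t₀ 1, s t ∈ U := by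
  have h : s ⁻¹' U ∈ 𝓝 (1 : I) := s.continuous.continuousAt.preimage_mem_nhds (by rwa [s.target])
  obtain ⟨l, hl, hlU⟩ := exists_Ioc_subset_of_mem_nhds h ⟨0, zero_lt_one⟩
  obtain ⟨t₀, h1, h2⟩ := exists_between hl
  exact ⟨t₀, h2, fun t ht => hlU ⟨h1.trans_le ht.1, ht.2⟩⟩

instance nhdsWithin_Iio_one_neBot : (𝓝[<] (1 : I)).NeBot :=
  nhdsLT_neBot_of_exists_lt ⟨0, zero_lt_one⟩

/-- If a solution can be continued along `s` up to the endpoint but not beyond, it tends to infinity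
there. -/
theorem tendsto_cocompact_of_not_regular {f : I → ℂ → ℂ} {w : ℂ}
    (h0 : IsAbelSolutionGerm p q a w (f 0)) (hf : IsContinuationAlong s (Set.Iio 1) f)
    (hsing : ¬ AbelRegularAlong p q s Set.univ w) :
    Tendsto (fun t => f t (s t)) (𝓝[<] 1) (cocompact ℂ) := by
  refine (hasBasis_cocompact.tendsto_right_iff).2 fun K hK => ?_
  by_contra hfreq
  have hfreq' : ∃ᶠ t in 𝓝[<] (1 : I), f t (s t) ∈ K := 
    (not_eventually.1 hfreq).mono fun t ht => not_not.1 ht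
  obtain ⟨y, -, hy⟩ := hK.exists_mapClusterPt_of_frequently hfreq'
  -- The disc around `b` does not depend on the initial data near `(b, y)`, so a solution started
  -- late enough with value near `y` covers the endpoint.
  obtain ⟨r, hr, Y, hY⟩ := exists_abel_local p q b y
  obtain ⟨t₀, ht₀, hs⟩ := s.exists_lt_one_forall_mem (Metric.ball_mem_nhds b hr)
  obtain ⟨t, hty, ht⟩ := ((hy.frequently (Metric.ball_mem_nhds y hr)).and_eventually
    (Ioo_mem_nhdsLT ht₀)).exists
  have h := hY (s t) (hs t ⟨ht.1.le, ht.2.le⟩) _ hty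
  obtain ⟨F, hF0, hF, -⟩ := exists_abel_extension h0
    (hf.mono fun t' (ht' : t' ≤ t) => ht'.trans_lt ht.2) ht.2.le (fun x hx => (h.2 x hx).1)
    (fun t' ht' => hs t' ⟨ht.1.le.trans ht'.1, ht'.2⟩) h.1.symm
  exact hsing ⟨F, hF0, hF.mono fun t' _ => unitInterval.le_one'⟩

/-- A first integral of the Abel equation in the coordinate `u = 1 / y`, holomorphic on a
neighbourhood of the bidisc `|x - b| < ε`, `|u| ≤ r`, and such that its level sets over the disc
`|x - b| < ε` do not meet `|u| = r`. -/
structure AbelFirstIntegral (p q : ℂ[X]) (b : ℂ) (ε r : ℝ) (C : ℂ × ℂ → ℂ) : Prop where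
  pos : 0 < ε
  radius_pos : 0 < r
  differentiableAt : ∀ x ∈ Metric.ball b ε, ∀ u, ‖u‖ ≤ r → DifferentiableAt ℂ C (x, u)
  fderiv_eq_zero : ∀ x ∈ Metric.ball b ε, ∀ u, ‖u‖ ≤ r →
    fderiv ℂ C (x, u) (-u, p.eval x * u + q.eval x) = 0
  fderiv_ne_zero : ∀ x ∈ Metric.ball b ε, ∀ u, ‖u‖ ≤ r → u ≠ 0 → fderiv ℂ C (x, u) (0, 1) ≠ 0
  apply_zero : ∀ x ∈ Metric.ball b ε, C (x, 0) = x
  apply_ne : ∀ u, ‖u‖ ≤ r → u ≠ 0 → C (b, u) ≠ b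
  apply_sphere_ne : ∀ x ∈ Metric.ball b ε, ∀ c ∈ Metric.ball b ε, ∀ u, ‖u‖ = r → C (x, u) ≠ c

/-- As `C (x, 0) = x`, the `x`-derivative of `C` is nonzero near `(b, 0)`; invariance under the
field then forces a nonzero `u`-derivative wherever `u ≠ 0`. So `C (b, ·) - b` is not identically
zero, and its isolated zero at `0` gives `r`. Compactness of the circle `|u| = r` then gives a bound
on `ε`. -/
theorem exists_abelFirstIntegral (p q : ℂ[X]) {b : ℂ} (hb : q.eval b ≠ 0) :
    ∃ C ε r, AbelFirstIntegral p q b ε r C := by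
  obtain ⟨C, hC, hC0, hCV⟩ := exists_firstIntegral p q hb
  have hdiff : ∀ᶠ m in 𝓝 (b, (0 : ℂ)), DifferentiableAt ℂ C m :=
    (hC.eventually (by simp)).mono fun l hl => hl.differentiableAt one_ne_zero
  have hCx : ∀ᶠ m in 𝓝 (b, (0 : ℂ)), fderiv ℂ C m (1, 0) ≠ 0 := by
    have hc : ContinuousAt (fun m => fderiv ℂ C m (1, 0)) (b, 0) := by
      have := hC.continuousAt_fderiv one_ne_zero
      fun_prop
    refine hc.eventually_ne ?_
    have h1 : HasDerivAt (fun x => C (x, 0)) (fderiv ℂ C (b, 0) (1, 0)) b :=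
      HasFDerivAt.comp_hasDerivAt (l := C) (f := fun x => (x, 0)) b
        (hC.differentiableAt one_ne_zero).hasFDerivAt
        ((hasDerivAt_id b).prodMk (hasDerivAt_const b (0 : ℂ)))
    have h2 : HasDerivAt (fun x => C (x, 0)) 1 b := (hasDerivAt_id b).congr_of_eventuallyEq hC0
    rw [h1.unique h2]
    exact one_ne_zero
  obtain ⟨R, hR, hball⟩ := Metric.eventually_nhds_iff_ball.1 (hdiff.and (hCV.and hCx))
  have hmem : ∀ x u : ℂ, dist x b < R → ‖u‖ < R → (x, u) ∈ Metric.ball (b, (0 : ℂ)) R := by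
    intro x u hx hu
    rw [Metric.mem_ball, Prod.dist_eq, max_lt_iff]
    exact ⟨hx, by simpa using hu⟩
  have hCu : ∀ x u : ℂ, dist x b < R → ‖u‖ < R → u ≠ 0 → fderiv ℂ C (x, u) (0, 1) ≠ 0 := by
    intro x u hx hu hu0 h
    obtain ⟨-, h1, h2⟩ := hball _ (hmem x u hx hu)
    have h3 : ((-u, p.eval x * u + q.eval x) : ℂ × ℂ) =
        (-u) • ((1 : ℂ), (0 : ℂ)) + (p.eval x * u + q.eval x) • ((0 : ℂ), (1 : ℂ)) := by
      simp
    simp only at h1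
    rw [h3, map_add, map_smul, map_smul, h, smul_zero, add_zero, smul_eq_mul] at h1
    exact mul_ne_zero (neg_ne_zero.2 hu0) h2 h1
  have hk : ∀ u : ℂ, ‖u‖ < R → HasDerivAt (fun u => C (b, u)) (fderiv ℂ C (b, u) (0, 1)) u :=
    fun u hu => HasFDerivAt.comp_hasDerivAt (l := C) (f := fun u => (b, u)) u
      (hball _ (hmem b u (by simpa using hR) hu)).1.hasFDerivAt
      ((hasDerivAt_const u b).prodMk (hasDerivAt_id u))
  have hka : AnalyticAt ℂ (fun u => C (b, u) - b) 0 := by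
    refine DifferentiableOn.analyticAt (s := Metric.ball 0 R) (fun u hu => ?_)
      (Metric.ball_mem_nhds _ hR)
    exact ((hk u (by simpa using hu)).sub_const b).differentiableAt.differentiableWithinAt
  have hne : ∀ᶠ u in 𝓝[≠] (0 : ℂ), C (b, u) - b ≠ 0 := by
    refine hka.eventually_eq_zero_or_eventually_ne_zero.resolve_left fun h => ?_
    obtain ⟨u, ⟨hu1, hu2⟩, hu0⟩ := ((mem_nhdsWithin_of_mem_nhds
      (inter_mem h.eventually_nhds (Metric.ball_mem_nhds (0 : ℂ) hR)) |> fun h =>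
        inter_mem h (self_mem_nhdsWithin (a := (0 : ℂ)) (s := {0}ᶜ))) |>
        Filter.nonempty_of_mem)
    have hu2' : ‖u‖ < R := by simpa using hu2
    have h1 : HasDerivAt (fun u => C (b, u) - b) 0 u :=
      (hasDerivAt_const u (0 : ℂ)).congr_of_eventuallyEq hu1
    exact hCu b u (by simpa using hR) hu2' hu0 (((hk u hu2').sub_const b).unique h1)
  obtain ⟨r', hr', hr'ne⟩ := Metric.mem_nhdsWithin_iff.1 hne
  obtain ⟨ε₀, hε₀, hε₀C⟩ := Metric.eventually_nhds_iff_ball.1 hC0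
  obtain ⟨r, hr, hrm⟩ := exists_between (lt_min hR hr')
  have hrR : r < R := hrm.trans_le (min_le_left _ _)
  have happly : ∀ u : ℂ, ‖u‖ ≤ r → u ≠ 0 → C (b, u) ≠ b := by
    intro u hu hu0
    have : u ∈ Metric.ball (0 : ℂ) r' ∩ {0}ᶜ :=
      ⟨by simpa using hu.trans_lt (hrm.trans_le (min_le_right _ _)), hu0⟩
    exact sub_ne_zero.1 (hr'ne this)
  have hsph : ∀ᶠ v in 𝓝 (b, b), ∀ u ∈ Metric.sphere (0 : ℂ) r, C (v.1, u) ≠ v.2 := by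
    refine (isCompact_sphere (0 : ℂ) r).eventually_forall_of_forall_eventually fun u hu => ?_
    have hu' : ‖u‖ = r := by simpa using hu
    have hCc : ContinuousAt C (b, u) :=
      (hball _ (hmem b u (by simpa using hR) (by linarith))).1.continuousAt
    have h1 : ContinuousAt (fun z : (ℂ × ℂ) × ℂ => C (z.1.1, z.2)) ((b, b), u) :=
      ContinuousAt.comp (g := C) (f := fun z : (ℂ × ℂ) × ℂ => (z.1.1, z.2)) hCc (by fun_prop)
    have h2 : ContinuousAt (fun z : (ℂ × ℂ) × ℂ => z.1.2) ((b, b), u) := by fun_prop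
    refine (h1.ne_iff_eventually_ne h2).1 (happly u hu'.le ?_)
    rintro rfl
    simp at hu'
    linarith
  obtain ⟨ε₁, hε₁, hε₁C⟩ := Metric.eventually_nhds_iff_ball.1 hsph
  refine ⟨C, min R (min ε₀ ε₁), r, lt_min hR (lt_min hε₀ hε₁), hr, ?_, ?_, ?_, ?_, happly, ?_⟩
  all_goals
    intro x hx
    rw [Metric.mem_ball, lt_min_iff, lt_min_iff] at hx
  · exact fun u hu => (hball _ (hmem x u hx.1 (hu.trans_lt hrR))).1
  · exact fun u hu => (hball _ (hmem x u hx.1 (hu.trans_lt hrR))).2.1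
  · exact fun u hu => hCu x u hx.1 (hu.trans_lt hrR)
  · exact hε₀C x hx.2.1
  · intro c hc u hu
    rw [Metric.mem_ball, lt_min_iff, lt_min_iff] at hc
    refine hε₁C (x, c) ?_ u (by simpa using hu)
    rw [Metric.mem_ball, Prod.dist_eq, max_lt_iff]
    exact ⟨hx.2.2, hc.2.2⟩

namespace AbelFirstIntegral

variable {ε r : ℝ} {C : ℂ × ℂ → ℂ}

theorem norm_inv_lt (hC : AbelFirstIntegral p q b ε r C) {y : ℂ} (hy : r⁻¹ < ‖y‖) : ‖y⁻¹‖ < r := by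
  rw [norm_inv]
  exact inv_lt_of_inv_lt₀ hC.radius_pos hy

theorem ne_zero (hC : AbelFirstIntegral p q b ε r C) {y : ℂ} (hy : r⁻¹ < ‖y‖) : y ≠ 0 :=
  norm_pos_iff.1 ((inv_pos.2 hC.radius_pos).trans hy)

/-- The tangent vector of the graph of `u = 1 / g` is `-g` times the field that annihilates `C`. -/
theorem hasDerivAt_zero (hC : AbelFirstIntegral p q b ε r C) {g : ℂ → ℂ} {x : ℂ}
    (hx : x ∈ Metric.ball b ε) (hg : AbelAt p q g x) (hgx : r⁻¹ < ‖g x‖) :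
    HasDerivAt (fun z => C (z, (g z)⁻¹)) 0 x := by
  have h0 := hC.ne_zero hgx
  have hle := (hC.norm_inv_lt hgx).le
  have h1 : HasDerivAt (fun z => C (z, (g z)⁻¹))
      (fderiv ℂ C (x, (g x)⁻¹) (1, -(p.eval x * g x ^ 2 + q.eval x * g x ^ 3) / g x ^ 2)) x :=
    HasFDerivAt.comp_hasDerivAt (l := C) (f := fun z => (z, (g z)⁻¹)) x
      (hC.differentiableAt x hx _ hle).hasFDerivAt ((hasDerivAt_id x).prodMk (hg.fun_inv h0))
  have h2 : ((1, -(p.eval x * g x ^ 2 + q.eval x * g x ^ 3) / g x ^ 2) : ℂ × ℂ) =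
      (-g x) • (-(g x)⁻¹, p.eval x * (g x)⁻¹ + q.eval x) := by
    ext
    · simp [h0]
    · simp only [Prod.smul_mk, smul_eq_mul]
      field_simp
  rwa [h2, map_smul, hC.fderiv_eq_zero x hx _ hle, smul_zero] at h1

/-- The first integral is locally constant along a solution. -/
theorem eventually_eq (hC : AbelFirstIntegral p q b ε r C) {g : ℂ → ℂ} {x : ℂ}
    (hx : x ∈ Metric.ball b ε) (hg : ∀ᶠ z in 𝓝 x, AbelAt p q g z) (hgx : r⁻¹ < ‖g x‖) :
    ∀ᶠ z in 𝓝 x, r⁻¹ < ‖g z‖ ∧ C (z, (g z)⁻¹) = C (x, (g x)⁻¹) := by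
  have hgc : ContinuousAt g x := HasDerivAt.continuousAt hg.self_of_nhds
  have h1 : ∀ᶠ z in 𝓝 x, r⁻¹ < ‖g z‖ := continuousAt_const.eventually_lt hgc.norm hgx
  obtain ⟨ρ, hρ, hball⟩ := Metric.eventually_nhds_iff_ball.1
    (h1.and (hg.and (Metric.isOpen_ball.mem_nhds hx)))
  filter_upwards [Metric.ball_mem_nhds x hρ] with z hz
  refine ⟨(hball z hz).1, ?_⟩
  exact eq_of_hasDerivAt_zero_on_ball (fun z hz => hC.hasDerivAt_zero (hball z hz).2.2
    (hball z hz).2.1 (hball z hz).1) hz (Metric.mem_ball_self hρ)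

/-- A solution on a disc stays on its level set of the first integral along the path. -/
theorem level_of_mem_Icc (hC : AbelFirstIntegral p q b ε r C) {g : ℂ → ℂ} {x₀ c : ℂ} {ρ : ℝ}
    {t₁ t₂ : I} (h12 : t₁ ≤ t₂) (hg : ∀ x ∈ Metric.ball x₀ ρ, AbelAt p q g x)
    (hsg : ∀ t ∈ Set.Icc t₁ t₂, s t ∈ Metric.ball x₀ ρ)
    (hs : ∀ t ∈ Set.Icc t₁ t₂, s t ∈ Metric.ball b ε) (hc : c ∈ Metric.ball b ε)
    (h₁ : r⁻¹ < ‖g (s t₁)‖ ∧ C (s t₁, (g (s t₁))⁻¹) = c) :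
    r⁻¹ < ‖g (s t₂)‖ ∧ C (s t₂, (g (s t₂))⁻¹) = c := by
  refine unitInterval_induction (P := fun t => r⁻¹ < ‖g (s t)‖ ∧ C (s t, (g (s t))⁻¹) = c)
    Set.ordConnected_Icc (Set.left_mem_Icc.2 h12) h₁ ?_ (Set.right_mem_Icc.2 h12) h12
  intro t ht
  have hst : Tendsto s (𝓝 t) (𝓝 (s t)) := s.continuous.tendsto t
  have hgs : ∀ᶠ x in 𝓝 (s t), AbelAt p q g x :=
    eventually_of_mem (Metric.isOpen_ball.mem_nhds (hsg t ht)) hg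
  have hgc : ContinuousAt g (s t) := HasDerivAt.continuousAt hgs.self_of_nhds
  -- The condition is open and so is its failure. The delicate case `|u| = r` is settled by
  -- `apply_sphere_ne`, which excludes the level `c` there.
  by_cases hP : r⁻¹ < ‖g (s t)‖ ∧ C (s t, (g (s t))⁻¹) = c
  · refine ⟨_, mem_nhdsWithin_of_mem_nhds (hst.eventually (hC.eventually_eq (hs t ht) hgs hP.1)),
      fun t₁' _ t₂' _ h hsub _ => ?_⟩
    have := hsub (Set.right_mem_Icc.2 h)
    exact ⟨this.1, this.2.trans hP.2⟩
  · suffices h : ∀ᶠ x in 𝓝 (s t), ¬ (r⁻¹ < ‖g x‖ ∧ C (x, (g x)⁻¹) = c) from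
      ⟨_, mem_nhdsWithin_of_mem_nhds (hst.eventually h),
        fun t₁' _ t₂' _ h' hsub hP' => absurd hP' (hsub (Set.left_mem_Icc.2 h'))⟩
    rcases lt_or_ge ‖g (s t)‖ r⁻¹ with hlt | hge
    · filter_upwards [hgc.norm.eventually_lt continuousAt_const hlt] with x hx h
      exact lt_asymm hx h.1
    · have hr := hC.radius_pos
      have h0 : g (s t) ≠ 0 := norm_pos_iff.1 ((inv_pos.2 hr).trans_le hge)
      have hle : ‖(g (s t))⁻¹‖ ≤ r := by
        rw [norm_inv]; exact inv_le_of_inv_le₀ hr hge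
      have hne : C (s t, (g (s t))⁻¹) ≠ c := by
        rcases hge.eq_or_lt with heq | hlt
        · exact hC.apply_sphere_ne _ (hs t ht) _ hc _ (by rw [norm_inv, ← heq, inv_inv])
        · exact fun h => hP ⟨hlt, h⟩
      have hCc : ContinuousAt (fun x => C (x, (g x)⁻¹)) (s t) :=
        ContinuousAt.comp (g := C) (f := fun x => (x, (g x)⁻¹))
          (hC.differentiableAt _ (hs t ht) _ hle).continuousAt
          (continuousAt_id.prodMk (hgc.inv₀ h0))
      filter_upwards [hCc.eventually_ne hne] with x hx h using hx h.2

/-- A solution on a level `c` of the first integral that is not a value of the path can be continued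
to the end of the path. -/
theorem regular_of_level (hC : AbelFirstIntegral p q b ε r C) {F : I → ℂ → ℂ} {w c : ℂ} {t₁ : I}
    (h0 : IsAbelSolutionGerm p q a w (F 0)) (hF : IsContinuationAlong s (Set.Iic t₁) F)
    (hs : ∀ t ∈ Set.Icc t₁ 1, s t ∈ Metric.ball b ε) (hc : c ∈ Metric.ball b ε)
    (hcs : ∀ t ∈ Set.Icc t₁ 1, s t ≠ c) (hFr : r⁻¹ < ‖F t₁ (s t₁)‖)
    (hFc : C (s t₁, (F t₁ (s t₁))⁻¹) = c) : AbelRegularAlong p q s Set.univ w := by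
  let D : Set (ℂ × ℂ) := (s '' Set.Icc t₁ 1) ×ˢ Metric.closedBall 0 r
  have hD : IsCompact D := (isCompact_Icc.image s.continuous).prod (isCompact_closedBall 0 r)
  have hmemD : ∀ m ∈ D, m.1 ∈ Metric.ball b ε ∧ m.1 ≠ c ∧ ‖m.2‖ ≤ r := by
    rintro m ⟨⟨t, ht, htm⟩, hm⟩
    exact ⟨htm ▸ hs t ht, htm ▸ hcs t ht, by simpa using hm⟩
  have hCD : ContinuousOn C D := fun m hm =>
    (hC.differentiableAt m.1 (hmemD m hm).1 m.2 (hmemD m hm).2.2).continuousAt.continuousWithinAt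
  have hL : IsCompact (D ∩ C ⁻¹' {c}) :=
    hD.of_isClosed_subset (hCD.preimage_isClosed_of_isClosed hD.isClosed isClosed_singleton)
      Set.inter_subset_left
  -- On this level `u ≠ 0`, because `C (x, 0) = x` and the path avoids `c`. Hence the values `y = 1
  -- / u` form a compact set, and one radius of existence serves for all of them.
  have hK : IsCompact ((fun m : ℂ × ℂ => (m.1, m.2⁻¹)) '' (D ∩ C ⁻¹' {c})) := by
    refine hL.image_of_continuousOn (continuousOn_fst.prodMk (continuousOn_snd.inv₀ ?_))
    rintro ⟨x, u⟩ hm rfl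
    have h1 := hmemD _ hm.1
    exact h1.2.1 ((hC.apply_zero x h1.1).symm.trans hm.2)
  obtain ⟨ρ, hρ, hex⟩ := exists_uniform_abel_radius p q hK
  have key : ∃ F : I → ℂ → ℂ, IsAbelSolutionGerm p q a w (F 0) ∧
      IsContinuationAlong s (Set.Iic 1) F ∧ r⁻¹ < ‖F 1 (s 1)‖ ∧
        C (s 1, (F 1 (s 1))⁻¹) = c := by
    refine unitInterval_induction (P := fun t => ∃ F : I → ℂ → ℂ,
      IsAbelSolutionGerm p q a w (F 0) ∧ IsContinuationAlong s (Set.Iic t) F ∧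
        r⁻¹ < ‖F t (s t)‖ ∧ C (s t, (F t (s t))⁻¹) = c) (J := Set.Icc t₁ 1) Set.ordConnected_Icc
      (Set.left_mem_Icc.2 unitInterval.le_one') ⟨F, h0, hF, hFr, hFc⟩ ?_
      (Set.right_mem_Icc.2 unitInterval.le_one') unitInterval.le_one'
    intro t ht
    refine ⟨s ⁻¹' Metric.ball (s t) (ρ / 2), mem_nhdsWithin_of_mem_nhds
      (s.continuous.continuousAt.preimage_mem_nhds (Metric.ball_mem_nhds _ (by positivity))), ?_⟩
    rintro τ hτ τ' hτ' hττ' hsub ⟨G, hG0, hG, hGr, hGc⟩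
    have hGm : (s τ, G τ (s τ)) ∈
        (fun m : ℂ × ℂ => (m.1, m.2⁻¹)) '' (D ∩ C ⁻¹' {c}) :=
      ⟨(s τ, (G τ (s τ))⁻¹), ⟨⟨⟨τ, hτ, rfl⟩, by simpa using (hC.norm_inv_lt hGr).le⟩, hGc⟩,
        by simp⟩
    obtain ⟨g, hg1, hg⟩ := hex _ hGm
    simp only at hg1 hg
    have hball : ∀ t' ∈ Set.Icc τ τ', s t' ∈ Metric.ball (s τ) ρ := by
      intro t' ht'
      have h1 : dist (s t') (s t) < ρ / 2 := hsub ht'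
      have h2 : dist (s τ) (s t) < ρ / 2 := hsub (Set.left_mem_Icc.2 hττ')
      rw [Metric.mem_ball]
      linarith [dist_triangle_right (s t') (s τ) (s t)]
    obtain ⟨G', hG'0, hG', hG'g⟩ := exists_abel_extension hG0 hG hττ' hg hball hg1.symm
    refine ⟨G', hG'0, hG', ?_⟩
    rw [hG'g]
    exact hC.level_of_mem_Icc hττ' hg hball
      (fun t' ht' => hs t' ⟨hτ.1.trans ht'.1, ht'.2.trans hτ'.2⟩) hc (by rw [hg1]; exact ⟨hGr, hGc⟩)
  obtain ⟨F, hF0, hF, -⟩ := key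
  exact ⟨F, hF0, hF.mono fun t _ => unitInterval.le_one'⟩

/-- A solution that tends to infinity at the end of the path lies on the level `b`. -/
theorem level_eq_endpoint (hC : AbelFirstIntegral p q b ε r C) {f : I → ℂ → ℂ} {w : ℂ} {t₁ : I}
    (h0 : IsAbelSolutionGerm p q a w (f 0)) (hf : IsContinuationAlong s (Set.Iio 1) f)
    (hinf : Tendsto (fun t => f t (s t)) (𝓝[<] 1) (cocompact ℂ)) (ht₁ : t₁ < 1)
    (hs : ∀ t ∈ Set.Icc t₁ 1, s t ∈ Metric.ball b ε)
    (hfr : ∀ t ∈ Set.Ico t₁ 1, r⁻¹ < ‖f t (s t)‖) :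
    C (s t₁, (f t₁ (s t₁))⁻¹) = b := by
  have hb : b ∈ Metric.ball b ε := Metric.mem_ball_self hC.pos
  have hconst : ∀ t ∈ Set.Ico t₁ 1, C (s t, (f t (s t))⁻¹) = C (s t₁, (f t₁ (s t₁))⁻¹) := by
    intro t ht
    refine unitInterval_induction
      (P := fun t => C (s t, (f t (s t))⁻¹) = C (s t₁, (f t₁ (s t₁))⁻¹)) (J := Set.Ico t₁ 1)
      Set.ordConnected_Ico (Set.left_mem_Ico.2 ht₁) rfl (fun t ht => ?_) ht ht.1
    have hsub : Set.Ico t₁ 1 ⊆ Set.Iio (1 : I) := fun t ht => ht.2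
    have h1 := hC.eventually_eq (hs t ⟨ht.1, ht.2.le⟩)
      (hf.eventually_abelAt Set.ordConnected_Iio (Set.mem_Iio.2 zero_lt_one) h0 ht.2) (hfr t ht)
    have hst : Tendsto s (𝓝[Set.Ico t₁ 1] t) (𝓝 (s t)) :=
      s.continuous.continuousAt.tendsto.mono_left nhdsWithin_le_nhds
    refine ⟨_, ((hf.mono hsub).compatible t ht).and (hst.eventually h1), ?_⟩
    rintro τ - τ' - hττ' hU hP
    have h2 := hU (Set.left_mem_Icc.2 hττ')
    have h3 := hU (Set.right_mem_Icc.2 hττ')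
    have e2 := h2.1.eq_of_nhds
    have e3 := h3.1.eq_of_nhds
    rw [← hP, e2, e3, h2.2.2, h3.2.2]
  have hinv : Tendsto (fun t => (f t (s t))⁻¹) (𝓝[<] 1) (𝓝 0) :=
    tendsto_inv₀_cobounded.comp (by rwa [Metric.cobounded_eq_cocompact])
  have hst : Tendsto s (𝓝[<] 1) (𝓝 b) := by
    have := s.continuous.tendsto 1
    rw [s.target] at this
    exact this.mono_left nhdsWithin_le_nhds
  have hlim : Tendsto (fun t => C (s t, (f t (s t))⁻¹)) (𝓝[<] 1) (𝓝 (C (b, 0))) :=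
    (hC.differentiableAt b hb 0 (by simpa using hC.radius_pos.le)).continuousAt.tendsto.comp
      (hst.prodMk_nhds hinv)
  rw [hC.apply_zero b hb] at hlim
  refine tendsto_nhds_unique (tendsto_const_nhds.congr' ?_) hlim
  filter_upwards [Ico_mem_nhdsLT ht₁] with t ht using (hconst t ht).symm

end AbelFirstIntegral

end Blowup

theorem proposition4p1 (p q : ℂ[X]) (a b : ℂ) (s : Path a b) (hb : q.eval b ≠ 0) (ya0 : ℂ)
    (hreg : AbelRegularAlong p q s (Set.Iio 1) ya0)
    (hsing : ¬ AbelRegularAlong p q s Set.univ ya0) :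
    ∃ (t₀ : unitInterval) (γ : unitInterval → ℂ), t₀ < 1 ∧ IsRealCurveGermLike s ya0 t₀ γ ∧
      ∀ᶠ ya in 𝓝 ya0, ya ∉ γ '' Set.Icc t₀ 1 → AbelRegularAlong p q s Set.univ ya := by
  obtain ⟨f, h0, hf⟩ := hreg
  have hinf := tendsto_cocompact_of_not_regular h0 hf hsing
  obtain ⟨C, ε, r, hC⟩ := exists_abelFirstIntegral p q hb
  obtain ⟨τ₁, hτ₁, hsε⟩ := s.exists_lt_one_forall_mem (Metric.ball_mem_nhds b hC.pos)
  have hlarge : ∀ᶠ t in 𝓝[<] (1 : unitInterval), r⁻¹ < ‖f t (s t)‖ := by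
    have : Tendsto (fun t => ‖f t (s t)‖) (𝓝[<] 1) atTop := tendsto_norm_cocompact_atTop.comp hinf
    exact this.eventually_gt_atTop _
  obtain ⟨l, hl, hlarge'⟩ := (mem_nhdsLT_iff_exists_Ioo_subset' (zero_lt_one' unitInterval)).1
    hlarge
  obtain ⟨τ₂, hlτ₂, hτ₂⟩ := exists_between (Set.mem_Iio.1 hl)
  let t₁ := max τ₁ τ₂
  have ht₁ : t₁ < 1 := max_lt hτ₁ hτ₂
  have hs₁ : ∀ t ∈ Set.Icc t₁ 1, s t ∈ Metric.ball b ε :=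
    fun t ht => hsε t ⟨(le_max_left _ _).trans ht.1, ht.2⟩
  have hfr : ∀ t ∈ Set.Ico t₁ 1, r⁻¹ < ‖f t (s t)‖ :=
    fun t ht => hlarge' ⟨hlτ₂.trans_le ((le_max_right _ _).trans ht.1), ht.2⟩
  have hlevel : ∀ t ∈ Set.Ico t₁ 1, C (s t, (f t (s t))⁻¹) = b := fun t ht =>
    hC.level_eq_endpoint h0 hf hinf ht.2 (fun t' ht' => hs₁ t' ⟨ht.1.trans ht'.1, ht'.2⟩)
      (fun t' ht' => hfr t' ⟨ht.1.trans ht'.1, ht'.2⟩)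
  -- The solution has a finite value on the level `b` here, but over `x = b` that level contains
  -- only `u = 0`.
  have hsb : ∀ t ∈ Set.Ico t₁ 1, s t ≠ b := by
    intro t ht h
    have h1 := hlevel t ht
    rw [h] at h1
    have h2 := hfr t ht
    rw [h] at h2
    exact hC.apply_ne _ (hC.norm_inv_lt h2).le (inv_ne_zero (hC.ne_zero h2)) h1
  have ht₁I : t₁ ∈ Set.Ico t₁ 1 := ⟨le_rfl, ht₁⟩
  obtain ⟨T, hTa, hTd, hT0, hTF⟩ :=
    exists_abel_transport Set.ordConnected_Iio (zero_lt_one' unitInterval) h0 hf ht₁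
  have hTr : r⁻¹ < ‖T ya0‖ := by rw [hT0]; exact hfr t₁ ht₁I
  have hT0' : T ya0 ≠ 0 := hC.ne_zero hTr
  have hx₁ := hs₁ t₁ ⟨le_rfl, ht₁.le⟩
  -- The level of the solution with initial value `w`, that is, the point where it would blow up.
  let c : ℂ → ℂ := fun w => C (s t₁, (T w)⁻¹)
  have hc0 : c ya0 = b := by
    have := hlevel t₁ ht₁I
    rwa [← hT0] at this
  have hCd : ∀ u : ℂ, ‖u‖ < r →
      HasDerivAt (fun u => C (s t₁, u)) (fderiv ℂ C (s t₁, u) (0, 1)) u := fun u hu =>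
    HasFDerivAt.comp_hasDerivAt (l := C) (f := fun u => (s t₁, u)) u
      (hC.differentiableAt _ hx₁ u hu.le).hasFDerivAt
      ((hasDerivAt_const u (s t₁)).prodMk (hasDerivAt_id u))
  have hur := hC.norm_inv_lt hTr
  have hca : AnalyticAt ℂ c ya0 := by
    have h1 : AnalyticAt ℂ (fun u => C (s t₁, u)) (T ya0)⁻¹ := by
      refine DifferentiableOn.analyticAt (s := Metric.ball 0 r) (fun u hu => ?_)
        (Metric.isOpen_ball.mem_nhds (by simpa using hur))
      exact (hCd u (by simpa using hu)).differentiableAt.differentiableWithinAt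
    exact AnalyticAt.comp (g := fun u => C (s t₁, u)) (f := fun w => (T w)⁻¹) h1 (hTa.inv hT0')
  have hcd : deriv c ya0 ≠ 0 := by
    have h1 : HasDerivAt c _ ya0 := HasDerivAt.comp ya0 (hCd _ hur)
      (hTa.differentiableAt.hasDerivAt.fun_inv hT0')
    rw [h1.deriv]
    exact mul_ne_zero (hC.fderiv_ne_zero _ hx₁ _ hur.le (inv_ne_zero hT0'))
      (div_ne_zero (neg_ne_zero.2 hTd) (pow_ne_zero 2 hT0'))
  have hcc : ContDiffAt ℂ 1 c ya0 := hca.contDiffAt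
  have hc' : HasFDerivAt c (ContinuousLinearEquiv.unitsEquivAut ℂ (Units.mk0 _ hcd) :
      ℂ →L[ℂ] ℂ) ya0 := by
    refine hca.differentiableAt.hasDerivAt.hasFDerivAt.congr_fderiv ?_
    ext
    simp
  let e := hcc.toOpenPartialHomeomorph c hc' one_ne_zero
  have hes : ya0 ∈ e.source := hcc.mem_toOpenPartialHomeomorph_source hc' one_ne_zero
  have hec : ⇑e = c := rfl
  have het : b ∈ e.target := hc0 ▸ hcc.image_mem_toOpenPartialHomeomorph_target hc' one_ne_zero
  have heb : e.symm b = ya0 := by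
    have := e.left_inv hes
    rwa [hec, hc0] at this
  have hed : ∀ᶠ x in 𝓝 b, DifferentiableAt ℂ e.symm x := by
    have := hcc.to_localInverse hc' one_ne_zero
    rw [hc0] at this
    exact (this.eventually (by simp)).mono fun x hx => hx.differentiableAt one_ne_zero
  obtain ⟨η, hη, hηV⟩ := Metric.eventually_nhds_iff_ball.1 (hed.and (e.open_target.mem_nhds het))
  obtain ⟨τ₀, hτ₀, hsV⟩ := s.exists_lt_one_forall_mem (Metric.ball_mem_nhds b hη)
  let t₀ := max τ₀ t₁
  have hsV' : ∀ t ∈ Set.Icc t₀ 1, s t ∈ Metric.ball b η :=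
    fun t ht => hsV t ⟨(le_max_left _ _).trans ht.1, ht.2⟩
  have ht₀ : t₀ < 1 := max_lt hτ₀ ht₁
  have hψd : DifferentiableOn ℂ e.symm (Metric.ball b η) :=
    fun x hx => (hηV x hx).1.differentiableWithinAt
  refine ⟨t₀, fun t => e.symm (s t), ht₀, ⟨?_, by simp [heb], Metric.ball b η, e.symm,
    Metric.isOpen_ball, Metric.mem_ball_self hη, hψd,
    e.symm.injOn.mono fun x hx => (hηV x hx).2, hsV', fun _ _ => rfl⟩, ?_⟩
  · exact hψd.continuousOn.comp s.continuous.continuousOn hsV'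
  -- The arc over `[t₁, t₀]` is compact and misses `b`, so levels close to `b` can meet the path
  -- only over `[t₀, 1]`, where `γ` records them.
  · have havoid : ∀ᶠ x in 𝓝 b, x ∉ s '' Set.Icc t₁ t₀ := by
      refine (isCompact_Icc.image s.continuous).isClosed.isOpen_compl.mem_nhds ?_
      rintro ⟨t, ht, hst⟩
      exact hsb t ⟨ht.1, ht.2.trans_lt ht₀⟩ hst
    have hct : Tendsto c (𝓝 ya0) (𝓝 b) := by
      have := hca.continuousAt.tendsto
      rwa [hc0] at this
    filter_upwards [e.open_source.mem_nhds hes, hct.eventually havoid,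
      hct.eventually (Metric.ball_mem_nhds b hC.pos),
      continuousAt_const.eventually_lt hTa.continuousAt.norm hTr, hTF]
      with w hw hwa hwε hwr ⟨F, hF0, hF, hFT⟩ hwγ
    refine hC.regular_of_level (c := c w) hF0 hF hs₁ hwε ?_ (by rwa [hFT]) (by rw [hFT])
    intro t ht hst
    rcases le_total t t₀ with h | h
    · exact hwa ⟨t, ⟨ht.1, h⟩, hst⟩
    · refine hwγ ⟨t, ⟨h, ht.2⟩, ?_⟩
      simp only [hst]
      exact e.left_inv hw
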